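/- Let $D\ge 3$ be an integer, let $X$ be the set of all $x\in\mathbb F_2^D$ of even Hamming weight $w(x)$, and let $\frac12 H(D,2)$ be the halved cube, i.e. the graph with vertex set $X$ in which $x,y$ are adjacent if and only if $w(x-y)=2$. Let $A\in{\rm Mat}_X(\mathbb C)$ be its adjacency matrix; its eigenvalues are $\theta_i=\frac12((D-2i)^2-D)$ for $0\le i\le\lfloor\frac D2\rfloor$. Let $E_1$ be the primitive idempotent associated with $\theta_1$, i.e. the orthogonal projection of $\mathbb C^X$ onto the $\theta_1$-eigenspace of $A$. Fix $x\in X$ and let $A^*=A^*(x)$ be the dual adjacency matrix with respect to $x$, i.e. the diagonal matrix with $A^*_{yy}=|X|\,(E_1)_{xy}$ for all $y\in X$ (explicitly $A^*_{yy}=D-2w(x-y)$). The Terwilliger algebra $\mathcal T=\mathcal T(x)$ is the (unital) subalgebra of ${\rm Mat}_X(\mathbb C)$ generated by $A$ and $A^*$. For even $k$ with $0\le k\le\lfloor\frac D2\rfloor$ let $M_k$ denote a $\mathcal T$-module of dimension $\lfloor\frac D2\rfloor-k+1$ with a $\mathbb C$-basis with respect to which $A$ is represented by the tridiagonal matrix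 with $(i,i)$-entry $\alpha_i=2i(D-2i-2k)-k$, $(i+1,i)$-entry $\beta_i=(i+1)(2i+1)$ and $(i-1,i)$-entry $\gamma_i=\frac12(D-2i-2k+1)(D-2i-2k+2)$, and $A^*$ is represented by the diagonal matrix with $(i,i)$-entry $\theta_i^*=D-2(2i+k)$, where rows and columns are indexed by $0,1,\dots,\lfloor\frac D2\rfloor-k$. For even $k$ with $2\le k\le\lceil\frac D2\rceil$ let $N_k$ denote a $\mathcal T$-module of dimension $\lceil\frac D2\rceil-k+1$ with a $\mathbb C$-basis with respect to which $A$ is represented by the tridiagonal matrix with $(i,i)$-entry $\alpha_i=(2i+1)(D-2i-2k+1)-k+1$, $(i+1,i)$-entry $\beta_i=(i+1)(2i+3)$ and $(i-1,i)$-entry $\gamma_i=\frac12(D-2i-2k+2)(D-2i-2k+3)$, and $A^*$ is represented by the diagonal matrix with $(i,i)$-entry $\theta_i^*=D-2(2i+k)$, where rows and columns are indexed by $0,1,\dots,\lceil\frac D2\rceil-k$. **Theorem 2.3.** Such modules $M_k$ and $N_k$ exist. However they are chosen, the modules $M_k$ ($k$ even, $0\le k\le\lfloor\frac D2\rfloor$)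 and $N_k$ ($k$ even, $2\le k\le\lceil\frac D2\rceil$) are irreducible, every irreducible $\mathcal T$-module is isomorphic to one of them, and they are mutually non-isomorphic. -/

import Mathlib

universe u v

/-- The vertex set of the `D`-dimensional halved cube: all vectors of `𝔽₂ ^ D` of even Hamming
weight. -/
abbrev HalvedCubeVertex (D : ℕ) : Type :=
  {x : Fin D → ZMod 2 // Even (hammingNorm x)}

/-- The `D`-dimensional halved cube: `x` and `y` are adjacent iff `w (x - y) = 2`. -/
def halvedCube (D : ℕ) : SimpleGraph (HalvedCubeVertex D) where
  Adj x y := hammingNorm (x.1 - y.1) = 2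
  symm := ⟨fun x y h => by
    have e : y.1 - x.1 = x.1 - y.1 := by
      rw [← neg_sub]
      exact funext fun i => ZMod.neg_eq_self_mod_two _
    rwa [e]⟩
  loopless := ⟨fun x h => by simp at h⟩

instance (D : ℕ) : DecidableRel (halvedCube D).Adj :=
  fun x y => inferInstanceAs (Decidable (hammingNorm (x.1 - y.1) = 2))

namespace HalvedCube

noncomputable section

/-- The adjacency matrix `A` of the halved cube. -/
def adjacency (D : ℕ) : Matrix (HalvedCubeVertex D) (HalvedCubeVertex D) ℂ :=
  (halvedCube D).adjMatrix ℂ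

/-- The eigenvalues `θ_i = ((D - 2 i)² - D) / 2` of `A`, for `0 ≤ i ≤ ⌊D / 2⌋`. -/
def eigenvalue (D i : ℕ) : ℂ :=
  (((D : ℂ) - 2 * i) ^ 2 - D) / 2

/-- The primitive idempotent `E_i` of the halved cube associated with `θ_i`: the matrix of the
orthogonal projection of `ℂ ^ X` onto the eigenspace of `A` for the eigenvalue `θ_i`. -/
def primitiveIdempotent (D i : ℕ) : Matrix (HalvedCubeVertex D) (HalvedCubeVertex D) ℂ :=
  Matrix.toEuclideanLin.symm
    ((Module.End.eigenspace (Matrix.toEuclideanLin (adjacency D))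
      (eigenvalue D i)).starProjection).toLinearMap

/-- The dual adjacency matrix `A* = A*(x)`: the diagonal matrix with `A*_{yy} = |X| (E_1)_{xy}`. -/
def dualAdjacency {D : ℕ} (x : HalvedCubeVertex D) :
    Matrix (HalvedCubeVertex D) (HalvedCubeVertex D) ℂ :=
  Matrix.diagonal fun y =>
    (Fintype.card (HalvedCubeVertex D) : ℂ) * primitiveIdempotent D 1 x y

/-- The Bose–Mesner algebra, generated by `A`. -/
def boseMesner (D : ℕ) : Subalgebra ℂ (Matrix (HalvedCubeVertex D) (HalvedCubeVertex D) ℂ) :=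
  Algebra.adjoin ℂ {adjacency D}

/-- The dual Bose–Mesner algebra with respect to `x`, generated by `A*(x)`. -/
def dualBoseMesner {D : ℕ} (x : HalvedCubeVertex D) :
    Subalgebra ℂ (Matrix (HalvedCubeVertex D) (HalvedCubeVertex D) ℂ) :=
  Algebra.adjoin ℂ {dualAdjacency x}

/-- The Terwilliger algebra `𝒯 = 𝒯(x)`, generated by the Bose–Mesner algebra and the dual
Bose–Mesner algebra. -/
def terwilliger {D : ℕ} (x : HalvedCubeVertex D) :
    Subalgebra ℂ (Matrix (HalvedCubeVertex D) (HalvedCubeVertex D) ℂ) :=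
  boseMesner D ⊔ dualBoseMesner x

/-- `A` as an element of `𝒯`. -/
def adjacencyT {D : ℕ} (x : HalvedCubeVertex D) : terwilliger x :=
  ⟨adjacency D, (le_sup_left : boseMesner D ≤ terwilliger x)
    (Algebra.subset_adjoin (Set.mem_singleton _))⟩

/-- `A*` as an element of `𝒯`. -/
def dualAdjacencyT {D : ℕ} (x : HalvedCubeVertex D) : terwilliger x :=
  ⟨dualAdjacency x, (le_sup_right : dualBoseMesner x ≤ terwilliger x)
    (Algebra.subset_adjoin (Set.mem_singleton _))⟩

/-- The `n × n` tridiagonal matrix with diagonal entries `α_0, …, α_{n-1}`, entry `β_i` in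
position `(i + 1, i)` and entry `γ_i` in position `(i - 1, i)`. -/
def tridiagonal (n : ℕ) (α β γ : ℕ → ℂ) : Matrix (Fin n) (Fin n) ℂ :=
  Matrix.of fun r c =>
    if (r : ℕ) = c then α r
    else if (r : ℕ) = c + 1 then β c
    else if (r : ℕ) + 1 = c then γ c
    else 0

/-- The `𝒯`-module `V` has a basis over `ℂ` with respect to which the matrices representing `A`
and `A*` are `B` and `Bs` (column `j` lists the coordinates of the image of the `j`-th basis
vector). -/
def RepresentedBy {D : ℕ} (x : HalvedCubeVertex D) {n : ℕ} (B Bs : Matrix (Fin n) (Fin n) ℂ)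
    (V : Type u) [AddCommGroup V] [Module ℂ V] [Module (terwilliger x) V] : Prop :=
  ∃ b : Module.Basis (Fin n) ℂ V, ∀ j,
    adjacencyT x • b j = ∑ i, B i j • b i ∧
    dualAdjacencyT x • b j = ∑ i, Bs i j • b i

/-- The matrix representing `A` on `M_k`, of size `⌊D / 2⌋ - k + 1`. -/
def matrixM (D k : ℕ) : Matrix (Fin (D / 2 - k + 1)) (Fin (D / 2 - k + 1)) ℂ :=
  tridiagonal (D / 2 - k + 1)
    (fun i => 2 * (i : ℂ) * ((D : ℂ) - 2 * i - 2 * k) - k)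
    (fun i => ((i : ℂ) + 1) * (2 * i + 1))
    (fun i => 1 / 2 * ((D : ℂ) - 2 * i - 2 * k + 1) * ((D : ℂ) - 2 * i - 2 * k + 2))

/-- The matrix representing `A` on `N_k`, of size `⌈D / 2⌉ - k + 1`; here `⌈D / 2⌉` is the natural
number quotient `(D + 1) / 2`. -/
def matrixN (D k : ℕ) : Matrix (Fin ((D + 1) / 2 - k + 1)) (Fin ((D + 1) / 2 - k + 1)) ℂ :=
  tridiagonal ((D + 1) / 2 - k + 1)
    (fun i => (2 * (i : ℂ) + 1) * ((D : ℂ) - 2 * i - 2 * k + 1) - k + 1)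
    (fun i => ((i : ℂ) + 1) * (2 * i + 3))
    (fun i => 1 / 2 * ((D : ℂ) - 2 * i - 2 * k + 2) * ((D : ℂ) - 2 * i - 2 * k + 3))

/-- The `n × n` diagonal matrix with entries `θ*_i = D - 2 (2 i + k)`, which represents `A*` on
`M_k` and on `N_k`. -/
def matrixDual (D k n : ℕ) : Matrix (Fin n) (Fin n) ℂ :=
  Matrix.diagonal fun i => (D : ℂ) - 2 * (2 * ((i : ℕ) : ℂ) + k)

/-- `V` is a `𝒯`-module `M_k` (meant for even `k` with `0 ≤ k ≤ ⌊D / 2⌋`). -/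
def IsM {D : ℕ} (x : HalvedCubeVertex D) (k : ℕ)
    (V : Type u) [AddCommGroup V] [Module ℂ V] [Module (terwilliger x) V] : Prop :=
  RepresentedBy x (matrixM D k) (matrixDual D k _) V

/-- `V` is a `𝒯`-module `N_k` (meant for even `k` with `2 ≤ k ≤ ⌈D / 2⌉`). -/
def IsN {D : ℕ} (x : HalvedCubeVertex D) (k : ℕ)
    (V : Type u) [AddCommGroup V] [Module ℂ V] [Module (terwilliger x) V] : Prop :=
  RepresentedBy x (matrixN D k) (matrixDual D k _) V

/-- The parameters `k` of the modules `M_k`: even integers with `0 ≤ k ≤ ⌊D / 2⌋`. -/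
def indexM (D : ℕ) : Set ℕ := {k | Even k ∧ k ≤ D / 2}

/-- The parameters `k` of the modules `N_k`: even integers with `2 ≤ k ≤ ⌈D / 2⌉`. -/
def indexN (D : ℕ) : Set ℕ := {k | Even k ∧ 2 ≤ k ∧ k ≤ (D + 1) / 2}

end

end HalvedCube

/-!
The halved cube sits inside the hypercube `Fin D → ZMod 2`, on which `𝔰𝔩₂` acts. With respect to
the base vertex `x` let `R` (`raise`) and `L` (`lower`) be the parts of the adjacency operator of
the hypercube that increase and decrease the distance of the support from `x` by one. Then
`L R - R L` is multiplication by `D - 2 w`, where `w` is the distance from `x` (`lower_raise_sub`).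
Moreover `A` is the restriction of `((L + R)² - D) / 2` to the halved cube (`adjacency_mulVec`), and
`A*` is the restriction of `D - 2 w` (`dualAdjacency_eq`). The latter needs the identification of
`E₁`, which is Fourier analysis: the `θ₁`-eigenspace of `A` is spanned by the characters attached to
single coordinates.

Take a nonzero `f` supported at distance `r` from `x` with `L f = 0` (`IsLowest`). Such `f` exist
exactly for `2 r ≤ D` (`exists_isLowest`, `IsLowest.raise_pow_ne_zero_iff`). On the string
`R ^ j f / j!`, `0 ≤ j ≤ D - 2 r`, the operators `L` and `R` act as shifts with explicit scalars.
The members that live on the halved cube are those with `r + j` even, and on them `A` and `A*` act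
by the prescribed matrices: if there are any, they span a copy of `M_r` if `r` is even and of `N_{r
+ 1}` if `r` is odd (`IsLowest.exists_isM`, `IsLowest.exists_isN`). All strings together span the
functions on the hypercube, because `L` and `R` are adjoint to each other (`stringSpan_eq_top`). So
the standard module `ℂ ^ X` is a sum of modules `M_k` and `N_k` (`sSup_isListed_eq_top`).

Each of these modules is irreducible, since `A*` is diagonal with distinct entries and `A` is
tridiagonal with nonzero off-diagonal entries (`RepresentedBy.isSimpleModule`). Hence the standard
module is semisimple. The algebra acts faithfully on it, so its regular module embeds in a power of
the standard module, and every irreducible module occurs in the standard module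
(`exists_isListed_equiv`). The largest eigenvalue `D - 2 k` of `A*` recovers `k`, and the
entry of `A` in position `(0, 0)` tells `M_k` from `N_k`.
-/

namespace HalvedCube

/-! ### Modules with a prescribed matrix representation -/

section Representation

variable {D : ℕ} {x : HalvedCubeVertex D}

theorem terwilliger_induction {P : terwilliger x → Prop}
    (algebraMap : ∀ c : ℂ, P (algebraMap ℂ _ c))
    (adjacency : P (adjacencyT x)) (dual : P (dualAdjacencyT x))
    (add : ∀ s t, P s → P t → P (s + t)) (mul : ∀ s t, P s → P t → P (s * t))
    (t : terwilliger x) : P t := by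
  have h : terwilliger x = Algebra.adjoin ℂ {HalvedCube.adjacency D, dualAdjacency x} := by
    rw [terwilliger, boseMesner, dualBoseMesner, ← Algebra.adjoin_union, Set.singleton_union]
  obtain ⟨t, ht⟩ := t
  have ht' := ht
  rw [h] at ht'
  induction ht' using Algebra.adjoin_induction with
  | mem y hy =>
    rcases hy with rfl | rfl
    · exact adjacency
    · exact dual
  | algebraMap r => exact algebraMap r
  | add y z hy hz h₁ h₂ => exact add ⟨y, h ▸ hy⟩ ⟨z, h ▸ hz⟩ (h₁ _) (h₂ _)
  | mul y z hy hz h₁ h₂ => exact mul ⟨y, h ▸ hy⟩ ⟨z, h ▸ hz⟩ (h₁ _) (h₂ _)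

variable {V : Type u} [AddCommGroup V] [Module ℂ V] [Module (terwilliger x) V]
  [IsScalarTower ℂ (terwilliger x) V]
  {V' : Type v} [AddCommGroup V'] [Module ℂ V'] [Module (terwilliger x) V']
  [IsScalarTower ℂ (terwilliger x) V']

theorem smul_mem_of_generators (p : Submodule ℂ V)
    (hA : ∀ w ∈ p, adjacencyT x • w ∈ p) (hAs : ∀ w ∈ p, dualAdjacencyT x • w ∈ p)
    (t : terwilliger x) {w : V} (hw : w ∈ p) : t • w ∈ p := by
  induction t using terwilliger_induction generalizing w with
  | algebraMap c => rw [algebraMap_smul]; exact p.smul_mem c hw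
  | adjacency => exact hA w hw
  | dual => exact hAs w hw
  | add s t hs ht => rw [add_smul]; exact p.add_mem (hs hw) (ht hw)
  | mul s t hs ht => rw [mul_smul]; exact hs (ht hw)

theorem map_smul_of_generators (φ : V →ₗ[ℂ] V')
    (hA : ∀ w, φ (adjacencyT x • w) = adjacencyT x • φ w)
    (hAs : ∀ w, φ (dualAdjacencyT x • w) = dualAdjacencyT x • φ w)
    (t : terwilliger x) (w : V) : φ (t • w) = t • φ w := by
  induction t using terwilliger_induction generalizing w with
  | algebraMap c => rw [algebraMap_smul, algebraMap_smul, map_smul]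
  | adjacency => exact hA w
  | dual => exact hAs w
  | add s t hs ht => rw [add_smul, add_smul, map_add, hs, ht]
  | mul s t hs ht => rw [mul_smul, mul_smul, hs, ht]

/-- The action of an element of the Terwilliger algebra as a `ℂ`-linear map. -/
abbrev actionMap (V : Type u) [AddCommGroup V] [Module ℂ V] [Module (terwilliger x) V]
    [IsScalarTower ℂ (terwilliger x) V] (t : terwilliger x) : V →ₗ[ℂ] V :=
  Algebra.lsmul ℂ ℂ V t

/-- The two matrices determine the module up to isomorphism. -/
theorem RepresentedBy.nonempty_equiv {n : ℕ} {B Bs : Matrix (Fin n) (Fin n) ℂ}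
    (h : RepresentedBy x B Bs V) (h' : RepresentedBy x B Bs V') :
    Nonempty (V ≃ₗ[terwilliger x] V') := by
  obtain ⟨b, hb⟩ := h
  obtain ⟨b', hb'⟩ := h'
  let e : V ≃ₗ[ℂ] V' := b.equiv b' (Equiv.refl _)
  have he : ∀ i, e (b i) = b' i := fun i => by simp [e]
  have hA : e.toLinearMap ∘ₗ actionMap V (adjacencyT x)
      = actionMap V' (adjacencyT x) ∘ₗ e.toLinearMap :=
    b.ext fun j => by
      change e (adjacencyT x • b j) = adjacencyT x • e (b j)
      rw [(hb j).1, he, (hb' j).1, map_sum]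
      simp only [map_smul, he]
  have hAs : e.toLinearMap ∘ₗ actionMap V (dualAdjacencyT x)
      = actionMap V' (dualAdjacencyT x) ∘ₗ e.toLinearMap :=
    b.ext fun j => by
      change e (dualAdjacencyT x • b j) = dualAdjacencyT x • e (b j)
      rw [(hb j).2, he, (hb' j).2, map_sum]
      simp only [map_smul, he]
  exact ⟨{ e with
    map_smul' := map_smul_of_generators e.toLinearMap (LinearMap.congr_fun hA)
      (LinearMap.congr_fun hAs) }⟩

theorem RepresentedBy.of_equiv {n : ℕ} {B Bs : Matrix (Fin n) (Fin n) ℂ}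
    (h : RepresentedBy x B Bs V) (e : V ≃ₗ[terwilliger x] V') : RepresentedBy x B Bs V' := by
  obtain ⟨b, hb⟩ := h
  have hs : ∀ (c : ℂ) (w : V), e (c • w) = c • e w := fun c w => by
    rw [← algebraMap_smul (terwilliger x) c w, map_smul, algebraMap_smul]
  refine ⟨b.map { e with map_smul' := hs }, fun j => ⟨?_, ?_⟩⟩
  · change adjacencyT x • e (b j) = ∑ i, B i j • e (b i)
    simp only [← map_smul, (hb j).1, map_sum, hs]
  · change dualAdjacencyT x • e (b j) = ∑ i, Bs i j • e (b i)
    simp only [← map_smul, (hb j).2, map_sum, hs]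

/-- A linearly independent family on which `A` and `A*` act through given matrices spans a
submodule for the Terwilliger algebra. -/
theorem exists_submodule_representedBy {n : ℕ} {B Bs : Matrix (Fin n) (Fin n) ℂ}
    {b : Fin n → V} (hb : LinearIndependent ℂ b)
    (hA : ∀ j, adjacencyT x • b j = ∑ i, B i j • b i)
    (hAs : ∀ j, dualAdjacencyT x • b j = ∑ i, Bs i j • b i) :
    ∃ S : Submodule (terwilliger x) V, (∀ j, b j ∈ S) ∧ RepresentedBy x B Bs S := by
  have hmem : ∀ i, b i ∈ Submodule.span ℂ (Set.range b) := fun i =>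
    Submodule.subset_span ⟨i, rfl⟩
  have key : ∀ (t : terwilliger x) (C : Matrix (Fin n) (Fin n) ℂ),
      (∀ j, t • b j = ∑ i, C i j • b i) →
      ∀ w ∈ Submodule.span ℂ (Set.range b), t • w ∈ Submodule.span ℂ (Set.range b) := by
    intro t C hC w hw
    have : Submodule.span ℂ (Set.range b)
        ≤ (Submodule.span ℂ (Set.range b)).comap (actionMap V t) := by
      rw [Submodule.span_le]
      rintro _ ⟨j, rfl⟩
      change t • b j ∈ Submodule.span ℂ (Set.range b)
      rw [hC j]
      exact Submodule.sum_mem _ fun i _ => Submodule.smul_mem _ _ (hmem i)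
    exact this hw
  let S : Submodule (terwilliger x) V :=
    { Submodule.span ℂ (Set.range b) with
      smul_mem' := fun t _ hw => smul_mem_of_generators _ (key _ _ hA) (key _ _ hAs) t hw }
  have hS : ∀ j, b j ∈ S := hmem
  let ι : S →ₗ[ℂ] V := S.subtype.restrictScalars ℂ
  have hι : Function.Injective ι := Subtype.val_injective
  let c : Fin n → S := fun j => ⟨b j, hS j⟩
  have hc : LinearIndependent ℂ c := LinearIndependent.of_comp ι hb
  have hspan : ⊤ ≤ Submodule.span ℂ (Set.range c) := by
    rintro ⟨w, hw⟩ -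
    have hw' : ι ⟨w, hw⟩ ∈ (Submodule.span ℂ (Set.range c)).map ι := by
      rw [Submodule.map_span, ← Set.range_comp]
      exact hw
    obtain ⟨w', hw', e⟩ := hw'
    rwa [← hι e]
  refine ⟨S, hS, Module.Basis.mk hc hspan, fun j => ⟨hι ?_, hι ?_⟩⟩
  · simp only [Module.Basis.mk_apply, map_sum, map_smul]
    exact hA j
  · simp only [Module.Basis.mk_apply, map_sum, map_smul]
    exact hAs j

/-- The primitive idempotents of a diagonalizable `A*` with distinct eigenvalues, obtained as
Lagrange interpolation polynomials in `A*`. -/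
theorem exists_smul_eq_ite {n : ℕ} {d : Fin n → ℂ} (hd : Function.Injective d) {b : Fin n → V}
    (hb : ∀ j, dualAdjacencyT x • b j = d j • b j) (i : Fin n) :
    ∃ t : terwilliger x, ∀ j, t • b j = if j = i then b j else 0 := by
  classical
  have key : ∀ (p : Polynomial ℂ) j,
      Polynomial.aeval (dualAdjacencyT x) p • b j = p.eval (d j) • b j := by
    intro p j
    induction p using Polynomial.induction_on' with
    | add p q hp hq => rw [map_add, add_smul, hp, hq, Polynomial.eval_add, add_smul]
    | monomial m a =>
      rw [Polynomial.aeval_monomial, mul_smul, algebraMap_smul, Polynomial.eval_monomial,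
        mul_smul]
      congr 1
      induction m with
      | zero => simp
      | succ m ih =>
        rw [pow_succ, mul_smul, hb, smul_comm, ih, smul_smul, pow_succ, mul_comm]
  refine ⟨Polynomial.aeval (dualAdjacencyT x) (Lagrange.basis Finset.univ d i), fun j => ?_⟩
  rw [key]
  split_ifs with h
  · subst h
    rw [Lagrange.eval_basis_self hd.injOn (Finset.mem_univ _), one_smul]
  · rw [Lagrange.eval_basis_of_ne (Ne.symm h) (Finset.mem_univ _), zero_smul]

theorem sum_diagonal_smul {n : ℕ} (d : Fin n → ℂ) (b : Fin n → V) (j : Fin n) :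
    ∑ i, Matrix.diagonal d i j • b i = d j • b j := by
  rw [Finset.sum_eq_single j]
  · rw [Matrix.diagonal_apply_eq]
  · intro i _ hi
    rw [Matrix.diagonal_apply_ne _ hi, zero_smul]
  · simp

/-- An irreducible tridiagonal matrix and a diagonal matrix with distinct entries leave no proper
nonzero subspace invariant. -/
theorem RepresentedBy.isSimpleModule {n : ℕ} {α β γ : ℕ → ℂ} {d : Fin (n + 1) → ℂ}
    (hd : Function.Injective d) (hβ : ∀ i < n, β i ≠ 0) (hγ : ∀ i, 0 < i → i ≤ n → γ i ≠ 0)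
    (h : RepresentedBy x (tridiagonal (n + 1) α β γ) (Matrix.diagonal d) V) :
    IsSimpleModule (terwilliger x) V := by
  obtain ⟨b, hb⟩ := h
  have : Nontrivial V := ⟨b 0, 0, b.ne_zero 0⟩
  choose t ht using exists_smul_eq_ite (b := b) hd
    (fun j => by rw [(hb j).2, sum_diagonal_smul])
  have htA : ∀ i (w : V), t i • w = b.repr w i • b i := by
    intro i w
    conv_lhs => rw [← b.sum_repr w]
    rw [Finset.smul_sum, Finset.sum_eq_single i]
    · rw [smul_comm, ht, if_pos rfl]
    · intro j _ hj
      rw [smul_comm, ht, if_neg hj, smul_zero]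
    · simp
  rw [isSimpleModule_iff]
  refine { eq_bot_or_eq_top := fun U => ?_ }
  have hcs : ∀ (c : ℂ) (w : V), c ≠ 0 → c • w ∈ U → w ∈ U := by
    intro c w hc hw
    have := U.smul_mem (algebraMap ℂ (terwilliger x) c⁻¹) hw
    rwa [algebraMap_smul, smul_smul, inv_mul_cancel₀ hc, one_smul] at this
  rw [or_iff_not_imp_left]
  intro hU
  obtain ⟨w, hwU, hw⟩ := (Submodule.ne_bot_iff U).1 hU
  obtain ⟨i, hi⟩ : ∃ i, b.repr w i ≠ 0 := by
    by_contra! hall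
    exact hw (b.repr.map_eq_zero_iff.1 (Finsupp.ext hall))
  have step : ∀ i j, b i ∈ U → tridiagonal (n + 1) α β γ j i ≠ 0 → b j ∈ U := by
    intro i j hi hne
    refine hcs _ _ hne ?_
    have := U.smul_mem (t j) (U.smul_mem (adjacencyT x) hi)
    rw [htA, (hb i).1, map_sum, Finset.sum_apply'] at this
    simpa [Finsupp.single_apply] using this
  have hiU : b i ∈ U := hcs _ _ hi (by rw [← htA]; exact U.smul_mem _ hwU)
  have hup : ∀ m (hm : m < n + 1), (i : ℕ) ≤ m → b ⟨m, hm⟩ ∈ U := by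
    intro m hm him
    induction m, him using Nat.le_induction with
    | base => exact hiU
    | succ m him ih =>
      refine step ⟨m, by omega⟩ _ (ih (by omega)) ?_
      simpa [tridiagonal] using hβ m (by omega)
  have hdown : ∀ k m (hm : m < n + 1), m + k = n → b ⟨m, hm⟩ ∈ U := by
    intro k
    induction k with
    | zero => exact fun m hm e => hup m hm (by omega)
    | succ k ih =>
      intro m hm e
      refine step ⟨m + 1, by omega⟩ _ (ih (m + 1) (by omega) (by omega)) ?_
      simpa [tridiagonal, show m ≠ m + 1 + 1 by omega] using hγ (m + 1) (by omega) (by omega)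
  rw [eq_top_iff]
  intro w _
  rw [← b.sum_repr w]
  refine Submodule.sum_mem _ fun j _ => ?_
  rw [← algebraMap_smul (terwilliger x)]
  exact U.smul_mem _ (hdown (n - j) j j.2 (by omega))

/-- An isomorphism matches the eigenvectors of `A*`; hence matched eigenvalues of `A*` carry equal
diagonal entries of the matrices that represent `A`. -/
theorem RepresentedBy.eigenvalue_match {n n' : ℕ} {B : Matrix (Fin n) (Fin n) ℂ}
    {B' : Matrix (Fin n') (Fin n') ℂ} {d : Fin n → ℂ} {d' : Fin n' → ℂ}
    (hd : Function.Injective d) (hd' : Function.Injective d')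
    (h : RepresentedBy x B (Matrix.diagonal d) V)
    (h' : RepresentedBy x B' (Matrix.diagonal d') V')
    (e : V ≃ₗ[terwilliger x] V') (i : Fin n) : ∃ i', d i = d' i' ∧ B i i = B' i' i' := by
  obtain ⟨b, hb⟩ := h
  obtain ⟨b', hb'⟩ := h'
  have hs : ∀ (c : ℂ) (w : V), e (c • w) = c • e w := fun c w => by
    rw [← algebraMap_smul (terwilliger x) c w, map_smul, algebraMap_smul]
  let P : Matrix (Fin n') (Fin n) ℂ := fun i' j => b'.repr (e (b j)) i'
  have repr_smul : ∀ (t : terwilliger x) (C' : Matrix (Fin n') (Fin n') ℂ),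
      (∀ j, t • b' j = ∑ i, C' i j • b' i) → ∀ (w : V') i',
      b'.repr (t • w) i' = ∑ j, C' i' j * b'.repr w j := by
    intro t C' hC' w i'
    conv_lhs => rw [← b'.sum_repr w]
    simp only [Finset.smul_sum, smul_comm t, hC', map_sum, map_smul, Finset.sum_apply',
      Finsupp.smul_apply, smul_eq_mul, Module.Basis.repr_self]
    refine Finset.sum_congr rfl fun j _ => ?_
    rw [mul_comm]
    simp [Finsupp.single_apply]
  have intertwine : ∀ (t : terwilliger x) (C : Matrix (Fin n) (Fin n) ℂ)
      (C' : Matrix (Fin n') (Fin n') ℂ), (∀ j, t • b j = ∑ i, C i j • b i) →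
      (∀ j, t • b' j = ∑ i, C' i j • b' i) → C' * P = P * C := by
    intro t C C' hC hC'
    ext i' j
    rw [Matrix.mul_apply, Matrix.mul_apply]
    have e₁ := repr_smul t C' hC' (e (b j)) i'
    rw [← map_smul, hC, map_sum, map_sum, Finset.sum_apply'] at e₁
    simp only [hs, map_smul, Finsupp.smul_apply, smul_eq_mul] at e₁
    rw [← e₁]
    exact Finset.sum_congr rfl fun k _ => mul_comm _ _
  have hPd : ∀ i' j, d' i' ≠ d j → P i' j = 0 := by
    intro i' j hne
    have := congr_fun₂ (intertwine _ _ _ (fun j => (hb j).2) fun j => (hb' j).2) i' j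
    rw [Matrix.diagonal_mul, Matrix.mul_diagonal] at this
    have h2 : (d' i' - d j) * P i' j = 0 := by linear_combination this
    exact (mul_eq_zero.1 h2).resolve_left (sub_ne_zero.2 hne)
  obtain ⟨i', hi'⟩ : ∃ i', P i' i ≠ 0 := by
    by_contra! hall
    have : e (b i) = 0 := b'.repr.map_eq_zero_iff.1 (Finsupp.ext hall)
    exact b.ne_zero i (e.map_eq_zero_iff.1 this)
  have hdi : d i = d' i' := by
    by_contra hne
    exact hi' (hPd _ _ (Ne.symm hne))
  refine ⟨i', hdi, ?_⟩
  have := congr_fun₂ (intertwine _ _ _ (fun j => (hb j).1) fun j => (hb' j).1) i' i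
  rw [Matrix.mul_apply, Matrix.mul_apply, Finset.sum_eq_single i', Finset.sum_eq_single i] at this
  · refine mul_left_cancel₀ hi' ?_
    rw [← this, mul_comm]
  · intro j _ hj
    rw [hPd _ _ (by rw [← hdi]; exact fun h => hj (hd h.symm)), zero_mul]
  · simp
  · intro j _ hj
    rw [hPd _ _ (by rw [hdi]; exact fun h => hj (hd' h)), mul_zero]
  · simp

/-- The action of a tridiagonal matrix on a family of vectors; indexing by `ℕ` lets the term after
the last one be `0`. -/
theorem sum_tridiagonal_smul {n : ℕ} (α β γ : ℕ → ℂ) {f : ℕ → V} (hf : f n = 0) (j : Fin n) :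
    ∑ i : Fin n, tridiagonal n α β γ i j • f i
      = α j • f j + β j • f (j + 1) + if (j : ℕ) = 0 then 0 else γ j • f (j - 1) := by
  obtain ⟨j, hj⟩ := j
  have h1 : ∀ i : ℕ, (if i = j then α i else if i = j + 1 then β j else
        if i + 1 = j then γ j else 0) • f i
      = (if i = j then α j • f j else 0) + (if i = j + 1 then β j • f (j + 1) else 0)
        + (if i + 1 = j then γ j • f (j - 1) else 0) := by
    intro i
    split_ifs <;> first | omega | skip
    all_goals simp_all
    all_goals (subst_vars; simp)
  have h2 : ∑ i ∈ Finset.range n, (if i + 1 = j then γ j • f (j - 1) else 0)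
      = if j = 0 then 0 else γ j • f (j - 1) := by
    rcases j with _ | j
    · simp
    · simp [show j < n by omega]
  calc ∑ i : Fin n, tridiagonal n α β γ i ⟨j, hj⟩ • f i
      = ∑ i ∈ Finset.range n, (if i = j then α i else if i = j + 1 then β j else
        if i + 1 = j then γ j else 0) • f i := by
        rw [← Fin.sum_univ_eq_sum_range]; rfl
    _ = _ := by
        simp only [h1, Finset.sum_add_distrib, h2, Finset.sum_ite_eq', Finset.mem_range, hj,
          if_true]
        split_ifs with h3 h4 h4
        · rfl
        · rfl
        · rw [show j + 1 = n by omega, hf, smul_zero]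
        · rw [show j + 1 = n by omega, hf, smul_zero]

end Representation

end HalvedCube

namespace HalvedCube

/-! ### Raising and lowering operators on the hypercube -/

section Hypercube

variable {D : ℕ}

/-- The vector `y` with its `i`-th coordinate changed. -/
def flip (i : Fin D) (y : Fin D → ZMod 2) : Fin D → ZMod 2 := y + Pi.single i 1

theorem flip_flip (i : Fin D) (y : Fin D → ZMod 2) : flip i (flip i y) = y := by
  rw [flip, flip, add_assoc, ← Pi.single_add, show (1 : ZMod 2) + 1 = 0 from rfl, Pi.single_zero,
    add_zero]

theorem flip_comm (i j : Fin D) (y : Fin D → ZMod 2) : flip i (flip j y) = flip j (flip i y) :=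
  add_right_comm _ _ _

theorem flip_apply_self (i : Fin D) (y : Fin D → ZMod 2) : flip i y i = y i + 1 := by
  simp [flip]

theorem flip_apply_of_ne {i j : Fin D} (h : j ≠ i) (y : Fin D → ZMod 2) : flip i y j = y j := by
  simp [flip, h]

theorem sum_flip {M : Type*} [AddCommMonoid M] (i : Fin D) (f : (Fin D → ZMod 2) → M) :
    ∑ y, f (flip i y) = ∑ y, f y :=
  Equiv.sum_comp (Function.Involutive.toPerm (flip i) (flip_flip i)) f

/-- The indicator of agreement of `x` and `y` in the coordinate `i`. -/
noncomputable def agree (x y : Fin D → ZMod 2) (i : Fin D) : ℂ := if x i = y i then 1 else 0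

theorem agree_mul_self (x y : Fin D → ZMod 2) (i : Fin D) :
    agree x y i * agree x y i = agree x y i := by
  unfold agree; split_ifs <;> simp

theorem agree_flip_self (x y : Fin D → ZMod 2) (i : Fin D) :
    agree x (flip i y) i = 1 - agree x y i := by
  have : ∀ a b : ZMod 2, (a = b + 1) ↔ ¬ (a = b) := by decide
  simp only [agree, flip_apply_self, this]
  split_ifs <;> simp

theorem agree_flip_of_ne (x y : Fin D → ZMod 2) {i j : Fin D} (h : j ≠ i) :
    agree x (flip i y) j = agree x y j := by
  rw [agree, agree, flip_apply_of_ne h]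

theorem sum_one_sub_agree (x y : Fin D → ZMod 2) :
    ∑ i, (1 - agree x y i) = (hammingDist x y : ℂ) := by
  rw [hammingDist, Finset.card_filter, Nat.cast_sum]
  refine Finset.sum_congr rfl fun i _ => ?_
  unfold agree
  split_ifs <;> simp_all

theorem sum_agree (x y : Fin D → ZMod 2) :
    ∑ i, agree x y i = (D : ℂ) - hammingDist x y := by
  rw [← sum_one_sub_agree, Finset.sum_sub_distrib]
  simp

theorem hammingDist_flip (x y : Fin D → ZMod 2) (i : Fin D) :
    (hammingDist x (flip i y) : ℂ) = hammingDist x y + 2 * agree x y i - 1 := by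
  rw [← sum_one_sub_agree, ← sum_one_sub_agree,
    ← Finset.add_sum_erase _ _ (Finset.mem_univ i),
    ← Finset.add_sum_erase (Finset.univ) (fun j => 1 - agree x y j) (Finset.mem_univ i),
    agree_flip_self, Finset.sum_congr rfl fun j hj => by
      rw [agree_flip_of_ne x y (Finset.ne_of_mem_erase hj)]]
  ring

/-- The raising operator with respect to the base vertex `x`: it moves functions supported at
distance `r` from `x` to functions supported at distance `r + 1`. -/
noncomputable def raise (x : Fin D → ZMod 2) :
    ((Fin D → ZMod 2) → ℂ) →ₗ[ℂ] ((Fin D → ZMod 2) → ℂ) where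
  toFun f y := ∑ i, (1 - agree x y i) * f (flip i y)
  map_add' f g := by ext y; simp [mul_add, Finset.sum_add_distrib]
  map_smul' c f := by ext y; simp [Finset.mul_sum, mul_left_comm]

/-- The lowering operator with respect to the base vertex `x`. -/
noncomputable def lower (x : Fin D → ZMod 2) :
    ((Fin D → ZMod 2) → ℂ) →ₗ[ℂ] ((Fin D → ZMod 2) → ℂ) where
  toFun f y := ∑ i, agree x y i * f (flip i y)
  map_add' f g := by ext y; simp [mul_add, Finset.sum_add_distrib]
  map_smul' c f := by ext y; simp [Finset.mul_sum, mul_left_comm]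

theorem raise_apply (x y : Fin D → ZMod 2) (f : (Fin D → ZMod 2) → ℂ) :
    raise x f y = ∑ i, (1 - agree x y i) * f (flip i y) := rfl

theorem lower_apply (x y : Fin D → ZMod 2) (f : (Fin D → ZMod 2) → ℂ) :
    lower x f y = ∑ i, agree x y i * f (flip i y) := rfl

/-- The `𝔰𝔩₂` commutation relation: the contributions of changing two distinct coordinates cancel,
and those of changing one coordinate twice count the agreements minus the disagreements. -/
theorem lower_raise_sub (x y : Fin D → ZMod 2) (f : (Fin D → ZMod 2) → ℂ) :
    lower x (raise x f) y = raise x (lower x f) y + ((D : ℂ) - 2 * hammingDist x y) * f y := by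
  have h : (D : ℂ) - 2 * hammingDist x y = ∑ i, (agree x y i - (1 - agree x y i)) := by
    rw [Finset.sum_sub_distrib, sum_agree, sum_one_sub_agree]
    ring
  rw [← sub_eq_iff_eq_add', h, Finset.sum_mul]
  simp only [raise_apply, lower_apply, Finset.mul_sum]
  rw [Finset.sum_comm (f := fun i j => (1 - agree x y i) * _), ← Finset.sum_sub_distrib]
  refine Finset.sum_congr rfl fun i _ => ?_
  rw [← Finset.sum_sub_distrib, Finset.sum_eq_single i]
  · rw [agree_flip_self, flip_flip]
    ring
  -- for `i ≠ j` the two double sums agree after exchanging `i` and `j`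
  · intro j _ hj
    rw [agree_flip_of_ne x y hj, agree_flip_of_ne x y hj.symm, flip_comm]
    ring
  · simp

/-- Functions supported at distance `r` from `x`. -/
def weightSpace (x : Fin D → ZMod 2) (r : ℕ) : Submodule ℂ ((Fin D → ZMod 2) → ℂ) where
  carrier := {f | ∀ y, hammingDist x y ≠ r → f y = 0}
  add_mem' hf hg y hy := by rw [Pi.add_apply, hf y hy, hg y hy, add_zero]
  zero_mem' _ _ := rfl
  smul_mem' c f hf y hy := by rw [Pi.smul_apply, hf y hy, smul_zero]

theorem raise_mem_weightSpace {x : Fin D → ZMod 2} {r : ℕ} {f : (Fin D → ZMod 2) → ℂ}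
    (hf : f ∈ weightSpace x r) : raise x f ∈ weightSpace x (r + 1) := by
  intro y hy
  rw [raise_apply]
  refine Finset.sum_eq_zero fun i _ => ?_
  by_cases h : x i = y i
  · simp [agree, h]
  · rw [hf _ ?_, mul_zero]
    have e := hammingDist_flip x y i
    simp only [agree, h, if_false] at e
    intro h'
    rw [h'] at e
    exact hy (by exact_mod_cast (by linear_combination -e : (hammingDist x y : ℂ) = r + 1))

theorem hammingDist_flip_of_agree {x y : Fin D → ZMod 2} {i : Fin D} (h : x i = y i) :
    hammingDist x (flip i y) = hammingDist x y + 1 := by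
  have e := hammingDist_flip x y i
  simp only [agree, h, if_true] at e
  exact_mod_cast (by linear_combination e :
    (hammingDist x (flip i y) : ℂ) = hammingDist x y + 1)

theorem lower_mem_weightSpace {x : Fin D → ZMod 2} {r : ℕ} {f : (Fin D → ZMod 2) → ℂ}
    (hf : f ∈ weightSpace x (r + 1)) : lower x f ∈ weightSpace x r := by
  intro y hy
  rw [lower_apply]
  refine Finset.sum_eq_zero fun i _ => ?_
  by_cases h : x i = y i
  · rw [hf _ ?_, mul_zero]
    rw [hammingDist_flip_of_agree h]
    omega
  · simp [agree, h]

theorem lower_eq_zero_of_mem_weightSpace_zero {x : Fin D → ZMod 2} {f : (Fin D → ZMod 2) → ℂ}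
    (hf : f ∈ weightSpace x 0) : lower x f = 0 := by
  funext y
  rw [lower_apply, Pi.zero_apply]
  refine Finset.sum_eq_zero fun i _ => ?_
  by_cases h : x i = y i
  · rw [hf _ ?_, mul_zero]
    rw [hammingDist_flip_of_agree h]
    omega
  · simp [agree, h]

theorem raise_pow_mem_weightSpace {x : Fin D → ZMod 2} {r : ℕ} {f : (Fin D → ZMod 2) → ℂ}
    (hf : f ∈ weightSpace x r) (j : ℕ) : (raise x ^ j) f ∈ weightSpace x (r + j) := by
  induction j with
  | zero => exact hf
  | succ j ih =>
    rw [pow_succ', Module.End.mul_apply, ← add_assoc]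
    exact raise_mem_weightSpace ih

theorem raise_pow_eq_zero {x : Fin D → ZMod 2} {r j : ℕ} {f : (Fin D → ZMod 2) → ℂ}
    (hf : f ∈ weightSpace x r) (h : D < r + j) : (raise x ^ j) f = 0 := by
  funext y
  refine raise_pow_mem_weightSpace hf j y ?_
  have := hammingDist_le_card_fintype (x := x) (y := y)
  rw [Fintype.card_fin] at this
  omega

/-- `f` is a lowest weight vector of weight `r`; the zero function is allowed. -/
structure IsLowest (x : Fin D → ZMod 2) (r : ℕ) (f : (Fin D → ZMod 2) → ℂ) : Prop where
  mem : f ∈ weightSpace x r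
  lower_eq_zero : lower x f = 0

theorem lower_raise_of_mem {x : Fin D → ZMod 2} {r : ℕ} {f : (Fin D → ZMod 2) → ℂ}
    (hf : f ∈ weightSpace x r) :
    lower x (raise x f) = raise x (lower x f) + ((D : ℂ) - 2 * r) • f := by
  funext y
  rw [lower_raise_sub, Pi.add_apply, Pi.smul_apply, smul_eq_mul]
  by_cases h : hammingDist x y = r
  · rw [h]
  · rw [hf y h, mul_zero, mul_zero]

theorem IsLowest.lower_raise_pow {x : Fin D → ZMod 2} {r : ℕ} {f : (Fin D → ZMod 2) → ℂ}
    (hf : IsLowest x r f) (j : ℕ) :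
    lower x ((raise x ^ (j + 1)) f) = (((j : ℂ) + 1) * (D - 2 * r - j)) • (raise x ^ j) f := by
  induction j with
  | zero =>
    rw [pow_one, pow_zero, lower_raise_of_mem hf.mem, hf.lower_eq_zero, map_zero]
    simp
  | succ j ih =>
    rw [pow_succ', Module.End.mul_apply, lower_raise_of_mem (raise_pow_mem_weightSpace hf.mem _),
      ih, map_smul, ← Module.End.mul_apply, ← pow_succ', ← add_smul]
    congr 1
    push_cast
    ring

/-- The string through a nonzero lowest weight vector of weight `r` ends exactly at weight
`D - r`. -/
theorem IsLowest.raise_pow_ne_zero_iff {x : Fin D → ZMod 2} {r : ℕ} {f : (Fin D → ZMod 2) → ℂ}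
    (hf : IsLowest x r f) (h0 : f ≠ 0) (j : ℕ) : (raise x ^ j) f ≠ 0 ↔ j + 2 * r ≤ D := by
  classical
  have hex : ∃ j, (raise x ^ j) f = 0 := ⟨D + 1, raise_pow_eq_zero hf.mem (by omega)⟩
  obtain ⟨n, hn⟩ : ∃ n, Nat.find hex = n + 1 := Nat.exists_eq_succ_of_ne_zero fun h => by
    have := Nat.find_spec hex
    rw [h] at this
    exact h0 this
  have h1 : (raise x ^ (n + 1)) f = 0 := hn ▸ Nat.find_spec hex
  have h2 : (raise x ^ n) f ≠ 0 := Nat.find_min hex (by omega)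
  -- applying the lowering operator to `R ^ (n + 1) f = 0` determines `n`
  have h3 := hf.lower_raise_pow n
  rw [h1, map_zero, eq_comm, smul_eq_zero, or_iff_left h2, mul_eq_zero,
    or_iff_right (by exact_mod_cast Nat.succ_ne_zero n)] at h3
  have h4 : D = n + 2 * r := by
    exact_mod_cast (by linear_combination h3 : (D : ℂ) = n + 2 * r)
  have h5 : (raise x ^ j) f ≠ 0 ↔ j < Nat.find hex := by
    refine ⟨fun h => ?_, fun h => Nat.find_min hex h⟩
    by_contra hlt
    obtain ⟨m, rfl⟩ := Nat.exists_eq_add_of_le' (not_lt.1 hlt)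
    exact h (by rw [pow_add, Module.End.mul_apply, Nat.find_spec hex, map_zero])
  rw [h5, hn]
  omega

/-- The divided power `R ^ j / j!` applied to `f`. -/
noncomputable def stringVector (x : Fin D → ZMod 2) (f : (Fin D → ZMod 2) → ℂ) (j : ℕ) :
    (Fin D → ZMod 2) → ℂ :=
  ((j.factorial : ℂ)⁻¹) • (raise x ^ j) f

theorem stringVector_mem {x : Fin D → ZMod 2} {r : ℕ} {f : (Fin D → ZMod 2) → ℂ}
    (hf : f ∈ weightSpace x r) (j : ℕ) : stringVector x f j ∈ weightSpace x (r + j) :=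
  Submodule.smul_mem _ _ (raise_pow_mem_weightSpace hf j)

theorem raise_stringVector (x : Fin D → ZMod 2) (f : (Fin D → ZMod 2) → ℂ) (j : ℕ) :
    raise x (stringVector x f j) = ((j : ℂ) + 1) • stringVector x f (j + 1) := by
  have h : ((j.factorial : ℂ)) ≠ 0 := by exact_mod_cast j.factorial_ne_zero
  have h' : (j : ℂ) + 1 ≠ 0 := by exact_mod_cast j.succ_ne_zero
  rw [stringVector, stringVector, map_smul, smul_smul, ← Module.End.mul_apply, ← pow_succ',
    Nat.factorial_succ]
  congr 1
  push_cast
  field_simp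

theorem IsLowest.lower_stringVector {x : Fin D → ZMod 2} {r : ℕ} {f : (Fin D → ZMod 2) → ℂ}
    (hf : IsLowest x r f) (j : ℕ) :
    lower x (stringVector x f (j + 1)) = ((D : ℂ) - 2 * r - j) • stringVector x f j := by
  have h : ((j.factorial : ℂ)) ≠ 0 := by exact_mod_cast j.factorial_ne_zero
  have h' : (j : ℂ) + 1 ≠ 0 := by exact_mod_cast j.succ_ne_zero
  rw [stringVector, stringVector, map_smul, hf.lower_raise_pow, smul_smul, smul_smul,
    Nat.factorial_succ]
  congr 1
  push_cast
  field_simp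

theorem IsLowest.lower_stringVector_zero {x : Fin D → ZMod 2} {r : ℕ}
    {f : (Fin D → ZMod 2) → ℂ} (hf : IsLowest x r f) : lower x (stringVector x f 0) = 0 := by
  simp [stringVector, hf.lower_eq_zero]

theorem IsLowest.stringVector_ne_zero_iff {x : Fin D → ZMod 2} {r : ℕ}
    {f : (Fin D → ZMod 2) → ℂ} (hf : IsLowest x r f) (h0 : f ≠ 0) (j : ℕ) :
    stringVector x f j ≠ 0 ↔ j + 2 * r ≤ D := by
  rw [stringVector, smul_ne_zero_iff, hf.raise_pow_ne_zero_iff h0,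
    and_iff_right (inv_ne_zero (by exact_mod_cast j.factorial_ne_zero))]

/-! ### Strings through lowest weight vectors span -/

/-- The raising and lowering operators are transposes of each other. -/
theorem sum_mul_raise (x : Fin D → ZMod 2) (f g : (Fin D → ZMod 2) → ℂ) :
    ∑ y, g y * raise x f y = ∑ y, lower x g y * f y := by
  simp only [raise_apply, lower_apply, Finset.mul_sum, Finset.sum_mul]
  rw [Finset.sum_comm, Finset.sum_comm (s := Finset.univ (α := Fin D → ZMod 2))
    (t := Finset.univ (α := Fin D)) (f := fun y i => agree x y i * g (flip i y) * f y)]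
  refine Finset.sum_congr rfl fun i _ => ?_
  rw [← sum_flip i]
  refine Finset.sum_congr rfl fun y _ => ?_
  rw [agree_flip_self, flip_flip]
  ring

/-- The span of all strings through lowest weight vectors. -/
def stringSpan (x : Fin D → ZMod 2) : Submodule ℂ ((Fin D → ZMod 2) → ℂ) :=
  Submodule.span ℂ {g | ∃ r f j, IsLowest x r f ∧ f ≠ 0 ∧ g = stringVector x f j}

theorem raise_mem_stringSpan {x : Fin D → ZMod 2} {g : (Fin D → ZMod 2) → ℂ}
    (hg : g ∈ stringSpan x) : raise x g ∈ stringSpan x := by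
  have : stringSpan x ≤ (stringSpan x).comap (raise x) := by
    rw [stringSpan, Submodule.span_le]
    rintro _ ⟨r, f, j, hf, h0, rfl⟩
    change raise x _ ∈ stringSpan x
    rw [raise_stringVector]
    exact Submodule.smul_mem _ _ (Submodule.subset_span ⟨r, f, j + 1, hf, h0, rfl⟩)
  exact this hg

theorem IsLowest.star {x : Fin D → ZMod 2} {r : ℕ} {f : (Fin D → ZMod 2) → ℂ}
    (hf : IsLowest x r f) : IsLowest x r (star f) := by
  refine ⟨fun y hy => ?_, ?_⟩
  · rw [Pi.star_apply, hf.mem y hy, star_zero]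
  · funext y
    have h := congr_arg Star.star (congr_fun hf.lower_eq_zero y)
    rw [lower_apply, star_sum, Pi.zero_apply, star_zero] at h
    rw [lower_apply, Pi.zero_apply, ← h]
    refine Finset.sum_congr rfl fun i _ => ?_
    rw [star_mul', Pi.star_apply]
    congr 1
    unfold agree
    split_ifs <;> simp

open scoped ComplexOrder in
/-- The annihilator of the strings is stable under the lowering operator, so a nonzero
homogeneous element of it would lead to a lowest weight vector orthogonal to all lowest weight
vectors. -/
theorem eq_zero_of_annihilates {x : Fin D → ZMod 2} (r : ℕ) {g : (Fin D → ZMod 2) → ℂ}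
    (hg : g ∈ weightSpace x r) (h : ∀ p ∈ stringSpan x, ∑ y, g y * p y = 0) : g = 0 := by
  induction r generalizing g with
  | zero =>
    have hl : IsLowest x 0 g := ⟨hg, lower_eq_zero_of_mem_weightSpace_zero hg⟩
    by_contra h0
    exact h0 (dotProduct_self_star_eq_zero.1 (h (Star.star g) (Submodule.subset_span
      ⟨0, Star.star g, 0, hl.star, star_ne_zero.2 h0, by simp [stringVector]⟩)))
  | succ r ih =>
    have hl : IsLowest x (r + 1) g := ⟨hg, ih (lower_mem_weightSpace hg) fun p hp => by
      rw [← sum_mul_raise]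
      exact h _ (raise_mem_stringSpan hp)⟩
    by_contra h0
    exact h0 (dotProduct_self_star_eq_zero.1 (h (Star.star g) (Submodule.subset_span
      ⟨r + 1, Star.star g, 0, hl.star, star_ne_zero.2 h0, by simp [stringVector]⟩)))

theorem stringSpan_eq_top (x : Fin D → ZMod 2) : stringSpan x = ⊤ := by
  classical
  by_contra hne
  obtain ⟨φ, hφ, hle⟩ := Submodule.exists_le_ker_of_lt_top _ (lt_top_iff_ne_top.2 hne)
  let g : (Fin D → ZMod 2) → ℂ := fun y => φ (Pi.single y 1)
  have hφg : ∀ p, φ p = ∑ y, g y * p y := by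
    intro p
    conv_lhs => rw [← Finset.univ_sum_single p]
    rw [map_sum]
    refine Finset.sum_congr rfl fun y _ => ?_
    have e : Pi.single y (p y) = p y • Pi.single y (1 : ℂ) := by
      rw [← Pi.single_smul, smul_eq_mul, mul_one]
    rw [e, map_smul, smul_eq_mul, mul_comm]
  have hg : ∀ p ∈ stringSpan x, ∑ y, g y * p y = 0 := fun p hp => by
    rw [← hφg]; exact hle hp
  -- the strings are homogeneous, so each homogeneous component of `g` annihilates them as well
  have hgr : ∀ r, (fun y => if hammingDist x y = r then g y else 0) = 0 := by
    intro r
    refine eq_zero_of_annihilates r (x := x) (fun y hy => if_neg hy) fun p hp => ?_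
    induction hp using Submodule.span_induction with
    | mem p hp =>
      obtain ⟨s, f, j, hf, h0, rfl⟩ := hp
      have hm := stringVector_mem hf.mem j
      by_cases hsr : s + j = r
      · rw [← hg (stringVector x f j) (Submodule.subset_span ⟨s, f, j, hf, h0, rfl⟩)]
        refine Finset.sum_congr rfl fun y _ => ?_
        split_ifs with hy
        · rfl
        · rw [hm y (by omega), mul_zero, mul_zero]
      · refine Finset.sum_eq_zero fun y _ => ?_
        split_ifs with hy
        · rw [hm y (by omega), mul_zero]
        · rw [zero_mul]
    | zero => simp
    | add p q _ _ hp hq => simp only [Pi.add_apply, mul_add, Finset.sum_add_distrib, hp, hq,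
        add_zero]
    | smul c p _ hp =>
      simp only [Pi.smul_apply, smul_eq_mul, mul_left_comm _ c, ← Finset.mul_sum, hp, mul_zero]
  refine hφ (LinearMap.ext fun p => ?_)
  rw [hφg, LinearMap.zero_apply]
  refine Finset.sum_eq_zero fun y _ => ?_
  have := congr_fun (hgr (hammingDist x y)) y
  rw [if_pos rfl] at this
  rw [this, Pi.zero_apply, zero_mul]

/-! ### Existence of lowest weight vectors -/

/-- For `2 r ≤ D` the product of `r` antisymmetrizers on disjoint pairs of coordinates is a lowest
weight vector of weight `r`. -/
theorem exists_isLowest (x : Fin D → ZMod 2) {r : ℕ} (hr : 2 * r ≤ D) :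
    ∃ f, IsLowest x r f ∧ f ≠ 0 := by
  classical
  obtain ⟨e⟩ : Nonempty ((Fin r ⊕ Fin r) ⊕ Fin (D - 2 * r) ≃ Fin D) :=
    Fintype.card_eq.1 (by simp; omega)
  let a : Fin r → Fin D := fun m => e (.inl (.inl m))
  let b : Fin r → Fin D := fun m => e (.inl (.inr m))
  let d : Fin (D - 2 * r) → Fin D := fun t => e (.inr t)
  let F : (Fin D → ZMod 2) → ℂ := fun y =>
    (∏ m, (agree x y (a m) - agree x y (b m))) * ∏ t, agree x y (d t)
  have hsum : ∀ G : Fin D → ℂ, ∑ i, G i = (∑ m, (G (a m) + G (b m))) + ∑ t, G (d t) := by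
    intro G
    rw [← e.sum_comp, Fintype.sum_sum_type, Fintype.sum_sum_type, Finset.sum_add_distrib]
  have hba : ∀ m m', b m ≠ a m' := fun m m' h => by simpa using e.injective h
  have hda : ∀ t m, d t ≠ a m := fun m m' h => by simpa using e.injective h
  have hdb : ∀ t m, d t ≠ b m := fun m m' h => by simpa using e.injective h
  have haa : ∀ m m', m' ≠ m → a m' ≠ a m := fun m m' hne h => by
    exact hne (by simpa using e.injective h)
  have hbb : ∀ m m', m' ≠ m → b m' ≠ b m := fun m m' hne h => by
    exact hne (by simpa using e.injective h)
  refine ⟨F, ⟨fun y hy => ?_, ?_⟩, fun h0 => ?_⟩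
  · by_contra hne
    obtain ⟨h1, h2⟩ := mul_ne_zero_iff.1 hne
    rw [Finset.prod_ne_zero_iff] at h1 h2
    refine hy ?_
    have e1 := sum_one_sub_agree x y
    have hpair : ∀ m, 1 - agree x y (a m) + (1 - agree x y (b m)) = 1 := by
      intro m
      have := h1 m (Finset.mem_univ _)
      revert this
      unfold agree
      split_ifs <;> simp
    have hrest : ∀ t, 1 - agree x y (d t) = 0 := by
      intro t
      have := h2 t (Finset.mem_univ _)
      revert this
      unfold agree
      split_ifs <;> simp
    simp only [hsum, hpair, hrest, Finset.sum_const, Finset.card_univ, Fintype.card_fin,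
      nsmul_eq_mul, mul_one, mul_zero, add_zero] at e1
    exact_mod_cast e1.symm
  · funext y
    rw [lower_apply, hsum, Pi.zero_apply]
    have hd : ∀ t, agree x y (d t) * F (flip (d t) y) = 0 := by
      intro t
      by_cases h : x (d t) = y (d t)
      · have : F (flip (d t) y) = 0 := by
          refine mul_eq_zero_of_right _ (Finset.prod_eq_zero (Finset.mem_univ t) ?_)
          rw [agree_flip_self, agree, if_pos h, sub_self]
        rw [this, mul_zero]
      · rw [agree, if_neg h, zero_mul]
    have hab : ∀ m, agree x y (a m) * F (flip (a m) y) + agree x y (b m) * F (flip (b m) y)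
        = 0 := by
      intro m
      have ea : F (flip (a m) y) = (1 - agree x y (a m) - agree x y (b m))
          * (∏ m' ∈ Finset.univ.erase m, (agree x y (a m') - agree x y (b m')))
          * ∏ t, agree x y (d t) := by
        simp only [F]
        rw [← Finset.mul_prod_erase _ _ (Finset.mem_univ m), agree_flip_self,
          agree_flip_of_ne x y (hba m m)]
        congr 2
        · refine Finset.prod_congr rfl fun m' hm' => ?_
          rw [agree_flip_of_ne x y (haa _ _ (Finset.ne_of_mem_erase hm')),
            agree_flip_of_ne x y (hba _ _)]
        · funext t
          rw [agree_flip_of_ne x y (hda _ _)]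
      have eb : F (flip (b m) y) = (agree x y (a m) - (1 - agree x y (b m)))
          * (∏ m' ∈ Finset.univ.erase m, (agree x y (a m') - agree x y (b m')))
          * ∏ t, agree x y (d t) := by
        simp only [F]
        rw [← Finset.mul_prod_erase _ _ (Finset.mem_univ m), agree_flip_self,
          agree_flip_of_ne x y (hba m m).symm]
        congr 2
        · refine Finset.prod_congr rfl fun m' hm' => ?_
          rw [agree_flip_of_ne x y (hbb _ _ (Finset.ne_of_mem_erase hm')),
            agree_flip_of_ne x y (hba _ _).symm]
        · funext t
          rw [agree_flip_of_ne x y (hdb _ _)]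
      rw [ea, eb]
      linear_combination (- (∏ m' ∈ Finset.univ.erase m, (agree x y (a m') - agree x y (b m')))
          * ∏ t, agree x y (d t)) * (agree_mul_self x y (a m) - agree_mul_self x y (b m))
    rw [Finset.sum_eq_zero fun m _ => hab m, Finset.sum_eq_zero fun t _ => hd t, add_zero]
  · -- the function is `± 1` at the vertex that differs from `x` in the first element of each pair
    let y : Fin D → ZMod 2 := fun i =>
      x i + Sum.elim (Sum.elim (fun _ => 1) fun _ => 0) (fun _ => 0) (e.symm i)
    have ha : ∀ m, agree x y (a m) = 0 := fun m => by simp [agree, y, a]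
    have hb : ∀ m, agree x y (b m) = 1 := fun m => by simp [agree, y, b]
    have hd : ∀ m, agree x y (d m) = 1 := fun m => by simp [agree, y, d]
    have := congr_fun h0 y
    simp [F, ha, hb, hd] at this

end Hypercube

end HalvedCube

namespace HalvedCube

/-! ### The adjacency matrix of the halved cube and the hypercube -/

section Adjacency

variable {D : ℕ}

theorem differ_flip_flip (y : Fin D → ZMod 2) {i j : Fin D} (h : i ≠ j) :
    (Finset.univ.filter fun k => y k ≠ flip i (flip j y) k) = {i, j} := by
  have hne : ∀ a : ZMod 2, a ≠ a + 1 := by decide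
  ext k
  simp only [Finset.mem_filter, Finset.mem_univ, true_and, Finset.mem_insert,
    Finset.mem_singleton]
  by_cases hi : k = i
  · subst hi
    rw [flip_apply_self, flip_apply_of_ne h]
    simp [hne]
  · rw [flip_apply_of_ne hi]
    by_cases hj : k = j
    · subst hj
      rw [flip_apply_self]
      simp [hne]
    · rw [flip_apply_of_ne hj]
      simp [hi, hj]

theorem eq_of_differ_eq {y z w : Fin D → ZMod 2}
    (h : (Finset.univ.filter fun k => y k ≠ z k) = Finset.univ.filter fun k => y k ≠ w k) :
    z = w := by
  have key : ∀ a b c : ZMod 2, (a ≠ b ↔ a ≠ c) → b = c := by decide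
  funext k
  have := Finset.ext_iff.1 h k
  simp only [Finset.mem_filter, Finset.mem_univ, true_and] at this
  exact key _ _ _ this

/-- The square of the adjacency operator of the hypercube counts each vertex at distance `2`
twice. -/
theorem sum_flip_flip (F : (Fin D → ZMod 2) → ℂ) (y : Fin D → ZMod 2) :
    ∑ i, ∑ j, F (flip i (flip j y))
      = D * F y + 2 * ∑ z with hammingDist y z = 2, F z := by
  have hdist : ∀ z, hammingDist y z = (Finset.univ.filter fun k => y k ≠ z k).card :=
    fun z => rfl
  rw [← Finset.sum_product', Finset.univ_product_univ,
    ← Finset.sum_filter_add_sum_filter_not _ (fun p : Fin D × Fin D => p.1 = p.2)]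
  congr 1
  · have h1 : ∀ p ∈ Finset.univ.filter (fun p : Fin D × Fin D => p.1 = p.2),
        F (flip p.1 (flip p.2 y)) = F y := by
      intro p hp
      rw [(Finset.mem_filter.1 hp).2, flip_flip]
    have h2 : (Finset.univ.filter (fun p : Fin D × Fin D => p.1 = p.2)).card = D := by
      have : Finset.univ.filter (fun p : Fin D × Fin D => p.1 = p.2)
          = (Finset.univ : Finset (Fin D)).diag := by
        ext p; simp
      rw [this, Finset.diag_card, Finset.card_univ, Fintype.card_fin]
    rw [Finset.sum_congr rfl h1, Finset.sum_const, h2, nsmul_eq_mul]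
  · rw [← Finset.sum_fiberwise_of_maps_to (t := Finset.univ.filter fun z => hammingDist y z = 2)
      (g := fun p : Fin D × Fin D => flip p.1 (flip p.2 y)), Finset.mul_sum]
    · refine Finset.sum_congr rfl fun z hz => ?_
      rw [Finset.mem_filter, hdist, Finset.card_eq_two] at hz
      obtain ⟨-, a, b, hab, hz⟩ := hz
      have hfib : (Finset.univ.filter (fun p : Fin D × Fin D => ¬ p.1 = p.2)).filter
          (fun p => flip p.1 (flip p.2 y) = z) = {(a, b), (b, a)} := by
        have hpair : ∀ i j : Fin D, i ≠ j →
            (flip i (flip j y) = z ↔ ({i, j} : Finset _) = {a, b}) :=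
          fun i j hij => ⟨fun h => by rw [← differ_flip_flip y hij, h, hz], fun h =>
            eq_of_differ_eq (y := y) (by rw [differ_flip_flip y hij, h, hz])⟩
        ext ⟨i, j⟩
        simp only [Finset.mem_filter, Finset.mem_univ, true_and, Finset.mem_insert,
          Finset.mem_singleton, Prod.mk.injEq]
        constructor
        · rintro ⟨hij, h⟩
          rw [hpair i j hij] at h
          have hi : i ∈ ({a, b} : Finset _) := h ▸ Finset.mem_insert_self _ _
          have hj : j ∈ ({a, b} : Finset _) := h ▸ (by simp)
          simp only [Finset.mem_insert, Finset.mem_singleton] at hi hj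
          grind
        · rintro (⟨rfl, rfl⟩ | ⟨rfl, rfl⟩)
          · exact ⟨hab, (hpair _ _ hab).2 rfl⟩
          · exact ⟨hab.symm, (hpair _ _ hab.symm).2 (Finset.pair_comm _ _)⟩
      rw [Finset.sum_congr rfl (g := fun _ => F z) fun p hp => by
        rw [(Finset.mem_filter.1 hp).2], hfib, Finset.sum_const,
        Finset.card_pair (by simp [hab]), nsmul_eq_mul, Nat.cast_ofNat]
    · intro p hp
      simp only [Finset.mem_filter, Finset.mem_univ, true_and] at hp ⊢
      rw [hdist, differ_flip_flip y hp, Finset.card_pair hp]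

theorem hammingNorm_sub_eq_hammingDist (x y : Fin D → ZMod 2) :
    hammingNorm (x - y) = hammingDist x y := by
  rw [hammingDist_comm, hammingDist_eq_hammingNorm, neg_add_eq_sub]

theorem cast_hammingDist (x y : Fin D → ZMod 2) :
    (hammingDist x y : ZMod 2) = ∑ i, x i + ∑ i, y i := by
  have key : ∀ a b : ZMod 2, (if a ≠ b then (1 : ZMod 2) else 0) = a + b := by decide
  rw [hammingDist, Finset.card_filter, Nat.cast_sum, ← Finset.sum_add_distrib]
  refine Finset.sum_congr rfl fun i _ => ?_
  rw [← key, Nat.cast_ite, Nat.cast_one, Nat.cast_zero]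

theorem even_hammingNorm_iff (y : Fin D → ZMod 2) : Even (hammingNorm y) ↔ ∑ i, y i = 0 := by
  rw [← ZMod.natCast_eq_zero_iff_even, ← hammingDist_zero_left, cast_hammingDist]
  simp

theorem even_hammingDist_iff (x : HalvedCubeVertex D) (y : Fin D → ZMod 2) :
    Even (hammingDist x.1 y) ↔ Even (hammingNorm y) := by
  rw [even_hammingNorm_iff, ← ZMod.natCast_eq_zero_iff_even, cast_hammingDist,
    (even_hammingNorm_iff _).1 x.2, zero_add]

theorem sum_flip_apply (i : Fin D) (y : Fin D → ZMod 2) : ∑ k, flip i y k = ∑ k, y k + 1 := by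
  simp [flip, Finset.sum_add_distrib]

/-- Up to scalars the adjacency matrix of the halved cube is the square of the adjacency operator of
the hypercube. -/
theorem adjacency_mulVec (F : (Fin D → ZMod 2) → ℂ) (y : HalvedCubeVertex D) :
    (adjacency D).mulVec (fun z => F z.1) y
      = (∑ i, ∑ j, F (flip i (flip j y.1)) - D * F y.1) / 2 := by
  have h : (adjacency D).mulVec (fun z => F z.1) y = ∑ z with hammingDist y.1 z = 2, F z := by
    have e : ∀ z : HalvedCubeVertex D, adjacency D y z * F z.1
        = if hammingDist y.1 z.1 = 2 then F z.1 else 0 := by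
      intro z
      rw [← hammingNorm_sub_eq_hammingDist, adjacency, SimpleGraph.adjMatrix_apply, ite_mul,
        one_mul, zero_mul]
      rfl
    rw [Matrix.mulVec, dotProduct, Finset.sum_congr rfl fun z _ => e z,
      ← Finset.sum_subtype (Finset.univ.filter fun z : Fin D → ZMod 2 => Even (hammingNorm z))
        (by simp) (fun z => if hammingDist y.1 z = 2 then F z else 0), ← Finset.sum_filter,
      Finset.filter_filter]
    refine Finset.sum_congr (Finset.filter_congr fun z _ => ?_) fun _ _ => rfl
    refine and_iff_right_of_imp fun hz => ?_
    rw [← even_hammingDist_iff y, hz]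
    exact even_two
  rw [h, sum_flip_flip]
  ring

/-! ### Characters of the hypercube and the primitive idempotent `E₁` -/

/-- The nontrivial additive character of `𝔽₂`. -/
def sign (a : ZMod 2) : ℂ := if a = 0 then 1 else -1

theorem sign_add (a b : ZMod 2) : sign (a + b) = sign a * sign b := by
  have key : ∀ a b : ZMod 2, (a + b = 0) ↔ (a = 0 ↔ b = 0) := by decide
  unfold sign
  rw [if_congr (key a b) rfl rfl]
  split_ifs <;> simp_all

theorem sign_mul_self (a : ZMod 2) : sign a * sign a = 1 := by
  unfold sign; split_ifs <;> simp

theorem sign_mul_sign (a b : ZMod 2) : sign a * sign b = if a = b then 1 else -1 := by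
  have key : ∀ a b : ZMod 2, (a + b = 0) ↔ a = b := by decide
  rw [← sign_add, sign, if_congr (key a b) rfl rfl]

theorem star_sign (a : ZMod 2) : star (sign a) = sign a := by
  unfold sign; split_ifs <;> simp

theorem sign_flip_self (i : Fin D) (y : Fin D → ZMod 2) : sign (flip i y i) = - sign (y i) := by
  rw [flip_apply_self, sign_add]
  simp [sign]

/-- The character of `𝔽₂ ^ D` attached to a set of coordinates. -/
def character (S : Finset (Fin D)) (y : Fin D → ZMod 2) : ℂ := ∏ i ∈ S, sign (y i)

theorem character_singleton (i : Fin D) (y : Fin D → ZMod 2) :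
    character {i} y = sign (y i) := Finset.prod_singleton _ _

theorem character_flip (S : Finset (Fin D)) (i : Fin D) (y : Fin D → ZMod 2) :
    character S (flip i y) = (if i ∈ S then -1 else 1) * character S y := by
  have hne : ∀ T : Finset (Fin D), i ∉ T → character T (flip i y) = character T y :=
    fun T hT => Finset.prod_congr rfl fun k hk => by
      rw [flip_apply_of_ne (ne_of_mem_of_not_mem hk hT)]
  split_ifs with h
  · have := hne (S.erase i) (Finset.notMem_erase i S)
    unfold character at this ⊢
    rw [← Finset.mul_prod_erase _ _ h, ← Finset.mul_prod_erase S (fun k => sign (y k)) h, this,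
      sign_flip_self]
    ring
  · rw [hne S h, one_mul]

theorem adjacency_mulVec_character (S : Finset (Fin D)) :
    (adjacency D).mulVec (fun z => character S z.1)
      = eigenvalue D S.card • fun z => character S z.1 := by
  have hsum : ∑ i : Fin D, (if i ∈ S then (-1 : ℂ) else 1) = D - 2 * S.card := by
    have : ∀ i : Fin D, (if i ∈ S then (-1 : ℂ) else 1) = 1 - 2 * if i ∈ S then 1 else 0 := by
      intro i; split_ifs <;> norm_num
    simp only [this, Finset.sum_sub_distrib, ← Finset.mul_sum]
    simp
  funext y
  rw [adjacency_mulVec]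
  simp only [character_flip, ← mul_assoc, ← Finset.sum_mul, ← Finset.mul_sum, hsum]
  rw [Pi.smul_apply, smul_eq_mul, eigenvalue]
  ring

theorem adjacency_transpose : (adjacency D).transpose = adjacency D :=
  SimpleGraph.transpose_adjMatrix _

theorem prod_sign (y : HalvedCubeVertex D) : ∏ i, sign (y.1 i) = 1 := by
  have : ∀ T : Finset (Fin D), ∏ i ∈ T, sign (y.1 i) = sign (∑ i ∈ T, y.1 i) := by
    intro T
    induction T using Finset.induction_on with
    | empty => simp [sign]
    | insert a T ha ih => rw [Finset.prod_insert ha, Finset.sum_insert ha, sign_add, ih]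
  rw [this, (even_hammingNorm_iff _).1 y.2, sign, if_pos rfl]

theorem character_compl (S : Finset (Fin D)) (y : HalvedCubeVertex D) :
    character Sᶜ y.1 = character S y.1 := by
  have h1 : character S y.1 * character Sᶜ y.1 = 1 := by
    rw [character, character, Finset.prod_mul_prod_compl, prod_sign]
  have h2 : character S y.1 * character S y.1 = 1 := by
    rw [character, ← Finset.prod_mul_distrib]
    exact Finset.prod_eq_one fun i _ => sign_mul_self _
  calc character Sᶜ y.1 = (character S y.1 * character S y.1) * character Sᶜ y.1 := by
        rw [h2, one_mul]
    _ = _ := by rw [mul_assoc, h1, mul_one]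

/-- A function on the halved cube is determined by its Fourier coefficients: the sum of
`character S z * character S y` over all `S` is `2 ^ D` for `y = z` and vanishes otherwise. -/
theorem eq_zero_of_character_dotProduct {g : HalvedCubeVertex D → ℂ}
    (h : ∀ S : Finset (Fin D), (fun y => character S y.1) ⬝ᵥ g = 0) : g = 0 := by
  funext z
  have h1 : ∑ S : Finset (Fin D), character S z.1 * ((fun y => character S y.1) ⬝ᵥ g) = 0 :=
    Finset.sum_eq_zero fun S _ => by rw [h, mul_zero]
  have h2 : ∀ y : HalvedCubeVertex D, ∑ S : Finset (Fin D), character S z.1 * character S y.1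
      = if y = z then 2 ^ D else 0 := by
    intro y
    simp only [character, ← Finset.prod_mul_distrib]
    rw [← Finset.powerset_univ, ← Finset.prod_one_add]
    simp only [sign_mul_sign]
    split_ifs with hyz
    · subst hyz
      simp
      norm_num
    · obtain ⟨i, hi⟩ : ∃ i, z.1 i ≠ y.1 i := by
        by_contra! hall
        exact hyz (Subtype.ext (funext fun i => (hall i).symm))
      exact Finset.prod_eq_zero (Finset.mem_univ i) (by rw [if_neg hi]; norm_num)
  simp only [dotProduct, Finset.mul_sum] at h1
  rw [Finset.sum_comm] at h1
  simp only [← mul_assoc, ← Finset.sum_mul, h2, ite_mul, zero_mul, Finset.sum_ite_eq',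
    Finset.mem_univ, if_true] at h1
  exact (mul_eq_zero.1 h1).resolve_left (pow_ne_zero _ two_ne_zero)

/-- Characters attached to distinct coordinates are orthogonal on the halved cube; since `3 ≤ D`, a
third coordinate is available to change the sign without leaving the halved cube. -/
theorem sum_sign_mul_sign (hD : 3 ≤ D) (i j : Fin D) :
    ∑ y : HalvedCubeVertex D, sign (y.1 i) * sign (y.1 j)
      = if i = j then (Fintype.card (HalvedCubeVertex D) : ℂ) else 0 := by
  split_ifs with hij
  · subst hij
    simp [sign_mul_self]
  · obtain ⟨k, hk⟩ : ∃ k, k ∉ ({i, j} : Finset (Fin D)) := by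
      by_contra! hall
      have h1 := Finset.card_le_card (fun k _ => hall k : Finset.univ ⊆ ({i, j} : Finset (Fin D)))
      rw [Finset.card_univ, Fintype.card_fin] at h1
      have := Finset.card_le_two (a := i) (b := j)
      omega
    simp only [Finset.mem_insert, Finset.mem_singleton, not_or] at hk
    have heven : ∀ y : HalvedCubeVertex D, Even (hammingNorm (flip i (flip k y.1))) := by
      intro y
      rw [even_hammingNorm_iff, sum_flip_apply, sum_flip_apply, (even_hammingNorm_iff _).1 y.2]
      rfl
    let σ : HalvedCubeVertex D → HalvedCubeVertex D := fun y => ⟨flip i (flip k y.1), heven y⟩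
    have hσ : Function.Involutive σ := fun y => Subtype.ext (by
      change flip i (flip k (flip i (flip k y.1))) = y.1
      rw [flip_comm k i, flip_flip, flip_flip])
    have h1 := Equiv.sum_comp (hσ.toPerm σ)
      (fun y : HalvedCubeVertex D => sign (y.1 i) * sign (y.1 j))
    have h2 : ∀ y : HalvedCubeVertex D, sign ((hσ.toPerm σ y).1 i) * sign ((hσ.toPerm σ y).1 j)
        = - (sign (y.1 i) * sign (y.1 j)) := by
      intro y
      change sign (flip i (flip k y.1) i) * sign (flip i (flip k y.1) j) = _
      rw [sign_flip_self, flip_apply_of_ne (Ne.symm hij), flip_apply_of_ne (Ne.symm hk.1),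
        flip_apply_of_ne (Ne.symm hk.2), neg_mul]
    simp only [h2, Finset.sum_neg_distrib] at h1
    exact self_eq_neg.1 h1.symm

/-- An explicit matrix, which turns out to be `E₁`: the normalized sum of the
projections onto the `D` characters attached to single coordinates. -/
noncomputable def firstIdempotent (D : ℕ) : Matrix (HalvedCubeVertex D) (HalvedCubeVertex D) ℂ :=
  Matrix.of fun y z =>
    (Fintype.card (HalvedCubeVertex D) : ℂ)⁻¹ * ∑ i, sign (y.1 i) * sign (z.1 i)

theorem card_ne_zero : (Fintype.card (HalvedCubeVertex D) : ℂ) ≠ 0 := by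
  have : Nonempty (HalvedCubeVertex D) := ⟨⟨0, by simp⟩⟩
  exact_mod_cast Fintype.card_ne_zero

theorem firstIdempotent_mulVec (f : HalvedCubeVertex D → ℂ) :
    (firstIdempotent D).mulVec f = ∑ i, ((Fintype.card (HalvedCubeVertex D) : ℂ)⁻¹ *
      ((fun y => character {i} y.1) ⬝ᵥ f)) • fun y : HalvedCubeVertex D => character {i} y.1 := by
  funext y
  simp only [Matrix.mulVec, dotProduct, firstIdempotent, Matrix.of_apply, Finset.sum_apply,
    Pi.smul_apply, smul_eq_mul, character_singleton, Finset.mul_sum, Finset.sum_mul]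
  rw [Finset.sum_comm]
  exact Finset.sum_congr rfl fun i _ => Finset.sum_congr rfl fun z _ => by ring

theorem firstIdempotent_transpose : (firstIdempotent D).transpose = firstIdempotent D := by
  ext y z
  simp only [Matrix.transpose_apply, firstIdempotent, Matrix.of_apply, mul_comm (sign (y.1 _))]

theorem firstIdempotent_conjTranspose :
    (firstIdempotent D).conjTranspose = firstIdempotent D := by
  ext y z
  simp only [Matrix.conjTranspose_apply, firstIdempotent, Matrix.of_apply, star_mul', star_sum,
    star_inv₀, star_natCast, star_sign, mul_comm (sign (y.1 _))]

theorem firstIdempotent_mulVec_character (hD : 3 ≤ D) (i : Fin D) :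
    (firstIdempotent D).mulVec (fun y => character {i} y.1) = fun y => character {i} y.1 := by
  rw [firstIdempotent_mulVec, Finset.sum_eq_single i]
  · simp only [dotProduct, character_singleton]
    rw [sum_sign_mul_sign hD, if_pos rfl, inv_mul_cancel₀ card_ne_zero, one_smul]
  · intro j _ hj
    simp only [dotProduct, character_singleton]
    rw [sum_sign_mul_sign hD, if_neg hj, mul_zero, zero_smul]
  · simp

theorem adjacency_mulVec_firstIdempotent (f : HalvedCubeVertex D → ℂ) :
    (adjacency D).mulVec ((firstIdempotent D).mulVec f)
      = eigenvalue D 1 • (firstIdempotent D).mulVec f := by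
  rw [firstIdempotent_mulVec, Matrix.mulVec_sum, Finset.smul_sum]
  refine Finset.sum_congr rfl fun i _ => ?_
  rw [Matrix.mulVec_smul, adjacency_mulVec_character, Finset.card_singleton, smul_comm]

theorem dotProduct_mulVec_of_transpose_eq {n : Type*} [Fintype n] {M : Matrix n n ℂ}
    (hM : M.transpose = M) (v w : n → ℂ) : v ⬝ᵥ M.mulVec w = M.mulVec v ⬝ᵥ w := by
  conv_rhs => rw [← hM]
  rw [Matrix.mulVec_transpose, Matrix.dotProduct_mulVec]

/-- On the `θ₁`-eigenspace the Fourier coefficients vanish except at sets of one element and their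
complements, and these define the same characters of the halved cube. -/
theorem firstIdempotent_mulVec_of_eigenvector (hD : 3 ≤ D) {f : HalvedCubeVertex D → ℂ}
    (hf : (adjacency D).mulVec f = eigenvalue D 1 • f) : (firstIdempotent D).mulVec f = f := by
  rw [← sub_eq_zero, ← neg_eq_zero, neg_sub]
  set g := f - (firstIdempotent D).mulVec f with hg
  have hAg : (adjacency D).mulVec g = eigenvalue D 1 • g := by
    rw [hg, Matrix.mulVec_sub, hf, adjacency_mulVec_firstIdempotent, smul_sub]
  have h1 : ∀ i : Fin D, (fun y : HalvedCubeVertex D => character {i} y.1) ⬝ᵥ g = 0 := by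
    intro i
    rw [hg, dotProduct_sub, dotProduct_mulVec_of_transpose_eq firstIdempotent_transpose,
      firstIdempotent_mulVec_character hD, sub_self]
  refine eq_zero_of_character_dotProduct fun S => ?_
  have h2 : (eigenvalue D S.card - eigenvalue D 1)
      * ((fun y : HalvedCubeVertex D => character S y.1) ⬝ᵥ g) = 0 := by
    have := dotProduct_mulVec_of_transpose_eq adjacency_transpose
      (fun y : HalvedCubeVertex D => character S y.1) g
    rw [hAg, adjacency_mulVec_character, smul_dotProduct, dotProduct_smul, smul_eq_mul,
      smul_eq_mul] at this
    linear_combination -this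
  rcases mul_eq_zero.1 h2 with h3 | h3
  -- `θ_s = θ₁` only for `s = 1` and `s = D - 1`
  · have h4 : ((S.card : ℂ) - 1) * (S.card - (D - 1)) = 0 := by
      simp only [eigenvalue, Nat.cast_one] at h3
      linear_combination h3 / 2
    rcases mul_eq_zero.1 h4 with h5 | h5
    · obtain ⟨i, rfl⟩ := Finset.card_eq_one.1 (by exact_mod_cast sub_eq_zero.1 h5 : S.card = 1)
      exact h1 i
    · have h6 : S.card + 1 = D := by
        exact_mod_cast (by linear_combination h5 : (S.card : ℂ) + 1 = D)
      have h7 : Sᶜ.card = 1 := by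
        rw [Finset.card_compl, Fintype.card_fin]; omega
      obtain ⟨i, hi⟩ := Finset.card_eq_one.1 h7
      simp only [← character_compl S, hi]
      exact h1 i
  · exact h3

theorem primitiveIdempotent_one (hD : 3 ≤ D) :
    primitiveIdempotent D 1 = firstIdempotent D := by
  rw [primitiveIdempotent, LinearEquiv.symm_apply_eq]
  refine LinearMap.ext fun v => ?_
  have hmem : ∀ w : EuclideanSpace ℂ (HalvedCubeVertex D),
      w ∈ Module.End.eigenspace (Matrix.toEuclideanLin (adjacency D)) (eigenvalue D 1) ↔
        (adjacency D).mulVec w.ofLp = eigenvalue D 1 • w.ofLp := by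
    intro w
    rw [Module.End.mem_eigenspace_iff, Matrix.toLpLin_apply]
    exact ⟨fun h => congr_arg WithLp.ofLp h, fun h => congr_arg (WithLp.toLp 2) h⟩
  refine Submodule.eq_starProjection_of_mem_of_inner_eq_zero ?_ fun w hw => ?_
  · rw [hmem]
    exact adjacency_mulVec_firstIdempotent v.ofLp
  · rw [hmem] at hw
    have hE := firstIdempotent_mulVec_of_eigenvector hD hw
    rw [EuclideanSpace.inner_eq_star_dotProduct, Matrix.toLpLin_apply]
    change w.ofLp ⬝ᵥ star (v.ofLp - (firstIdempotent D).mulVec v.ofLp) = 0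
    rw [star_sub, Matrix.star_mulVec, firstIdempotent_conjTranspose, dotProduct_sub,
      ← Matrix.mulVec_transpose, firstIdempotent_transpose,
      dotProduct_mulVec_of_transpose_eq firstIdempotent_transpose, hE, sub_self]

theorem dualAdjacency_eq (hD : 3 ≤ D) (x : HalvedCubeVertex D) :
    dualAdjacency x = Matrix.diagonal fun y => (D : ℂ) - 2 * hammingDist x.1 y.1 := by
  rw [dualAdjacency]
  congr 1
  funext y
  rw [primitiveIdempotent_one hD, firstIdempotent, Matrix.of_apply,
    mul_inv_cancel_left₀ card_ne_zero]
  have : ∀ i, sign (x.1 i) * sign (y.1 i) = 1 - 2 * (1 - agree x.1 y.1 i) := by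
    intro i
    rw [sign_mul_sign, agree]
    split_ifs <;> norm_num
  simp only [this, Finset.sum_sub_distrib, ← Finset.mul_sum]
  rw [← sum_one_sub_agree, Finset.sum_sub_distrib]
  simp

end Adjacency

end HalvedCube

namespace HalvedCube

/-! ### The standard module and its decomposition -/

section StandardModule

variable {D : ℕ}

/-- The standard module `ℂ ^ X` of the Terwilliger algebra `𝒯(x)`. It is a type synonym of the
function type, on which no action of matrices is installed. -/
def StandardModule {D : ℕ} (_x : HalvedCubeVertex D) : Type := HalvedCubeVertex D → ℂ

instance (x : HalvedCubeVertex D) : AddCommGroup (StandardModule x) :=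
  inferInstanceAs (AddCommGroup (HalvedCubeVertex D → ℂ))

noncomputable instance (x : HalvedCubeVertex D) : Module ℂ (StandardModule x) :=
  inferInstanceAs (Module ℂ (HalvedCubeVertex D → ℂ))

noncomputable instance (x : HalvedCubeVertex D) : Module (terwilliger x) (StandardModule x) where
  smul t f := t.1.mulVec f
  one_smul f := Matrix.one_mulVec f
  mul_smul s t f := (Matrix.mulVec_mulVec f s.1 t.1).symm
  smul_zero t := Matrix.mulVec_zero t.1
  smul_add t f g := Matrix.mulVec_add t.1 f g
  add_smul s t f := Matrix.add_mulVec s.1 t.1 f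
  zero_smul f := Matrix.zero_mulVec f

instance (x : HalvedCubeVertex D) : IsScalarTower ℂ (terwilliger x) (StandardModule x) where
  smul_assoc c t f := Matrix.smul_mulVec c t.1 f

/-- Restriction of functions from the hypercube to the halved cube. -/
noncomputable def restrict (x : HalvedCubeVertex D) :
    ((Fin D → ZMod 2) → ℂ) →ₗ[ℂ] StandardModule x :=
  LinearMap.funLeft ℂ ℂ Subtype.val

theorem restrict_surjective (x : HalvedCubeVertex D) : Function.Surjective (restrict x) :=
  LinearMap.funLeft_surjective_of_injective ℂ ℂ _ Subtype.val_injective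

theorem adjacencyT_smul_restrict (x : HalvedCubeVertex D) (F : (Fin D → ZMod 2) → ℂ) :
    adjacencyT x • restrict x F = restrict x ((1 / 2 : ℂ) •
      ((lower x.1 + raise x.1) ((lower x.1 + raise x.1) F) - (D : ℂ) • F)) := by
  have h : ∀ G y, (lower x.1 + raise x.1) G y = ∑ i, G (flip i y) := by
    intro G y
    rw [LinearMap.add_apply, Pi.add_apply, lower_apply, raise_apply, ← Finset.sum_add_distrib]
    exact Finset.sum_congr rfl fun i _ => by ring
  refine funext fun y => ?_
  refine (adjacency_mulVec F y).trans ?_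
  change _ = (1 / 2 : ℂ) * ((lower x.1 + raise x.1) ((lower x.1 + raise x.1) F) y.1 - D * F y.1)
  simp only [h, flip_comm]
  ring

theorem dualAdjacencyT_smul_restrict (hD : 3 ≤ D) (x : HalvedCubeVertex D) {r : ℕ}
    {F : (Fin D → ZMod 2) → ℂ} (hF : F ∈ weightSpace x.1 r) :
    dualAdjacencyT x • restrict x F = ((D : ℂ) - 2 * r) • restrict x F := by
  refine funext fun y => ?_
  change (dualAdjacency x).mulVec (fun z : HalvedCubeVertex D => F z.1) y
    = ((D : ℂ) - 2 * r) * F y.1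
  rw [dualAdjacency_eq hD, Matrix.mulVec_diagonal]
  by_cases h : hammingDist x.1 y.1 = r
  · rw [h]
  · rw [hF _ h, mul_zero, mul_zero]

theorem restrict_eq_zero_iff (x : HalvedCubeVertex D) {r : ℕ} (hr : Even r)
    {F : (Fin D → ZMod 2) → ℂ} (hF : F ∈ weightSpace x.1 r) : restrict x F = 0 ↔ F = 0 := by
  refine ⟨fun h => funext fun y => ?_, fun h => by rw [h, map_zero]⟩
  by_cases hy : hammingDist x.1 y = r
  · exact congr_fun h ⟨y, (even_hammingDist_iff x y).1 (hy ▸ hr)⟩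
  · exact hF y hy

theorem restrict_eq_zero_of_odd (x : HalvedCubeVertex D) {r : ℕ} (hr : ¬ Even r)
    {F : (Fin D → ZMod 2) → ℂ} (hF : F ∈ weightSpace x.1 r) : restrict x F = 0 :=
  funext fun y => hF y.1 fun h => hr (h ▸ (even_hammingDist_iff x y.1).2 y.2)

theorem IsLowest.adjacencyT_smul_add_two {x : HalvedCubeVertex D} {r : ℕ}
    {f : (Fin D → ZMod 2) → ℂ} (hf : IsLowest x.1 r f) (j : ℕ) :
    adjacencyT x • restrict x (stringVector x.1 f (j + 2))
      = (((j + 3) * (D - 2 * r - (j + 2)) + (j + 2) * (D - 2 * r - (j + 2) + 1) - D) / 2 : ℂ)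
          • restrict x (stringVector x.1 f (j + 2))
        + ((j + 3) * (j + 4) / 2 : ℂ) • restrict x (stringVector x.1 f (j + 4))
        + ((D - 2 * r - (j + 2) + 1) * (D - 2 * r - (j + 2) + 2) / 2 : ℂ)
          • restrict x (stringVector x.1 f j) := by
  rw [adjacencyT_smul_restrict]
  simp only [← map_smul, ← map_add]
  congr 1
  simp only [LinearMap.add_apply, hf.lower_stringVector, raise_stringVector, map_add, map_smul,
    smul_add, add_assoc, smul_smul, Nat.reduceAdd]
  push_cast
  module

theorem IsLowest.adjacencyT_smul_zero {x : HalvedCubeVertex D} {r : ℕ}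
    {f : (Fin D → ZMod 2) → ℂ} (hf : IsLowest x.1 r f) :
    adjacencyT x • restrict x (stringVector x.1 f 0)
      = (-r : ℂ) • restrict x (stringVector x.1 f 0)
        + (1 : ℂ) • restrict x (stringVector x.1 f 2) := by
  rw [adjacencyT_smul_restrict]
  simp only [← map_smul, ← map_add]
  congr 1
  simp only [LinearMap.add_apply, hf.lower_stringVector, hf.lower_stringVector_zero,
    raise_stringVector, map_add, map_smul, map_zero, smul_add, smul_smul, Nat.reduceAdd]
  push_cast
  module

theorem IsLowest.adjacencyT_smul_one {x : HalvedCubeVertex D} {r : ℕ}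
    {f : (Fin D → ZMod 2) → ℂ} (hf : IsLowest x.1 r f) :
    adjacencyT x • restrict x (stringVector x.1 f 1)
      = (D - 3 * r - 1 : ℂ) • restrict x (stringVector x.1 f 1)
        + (3 : ℂ) • restrict x (stringVector x.1 f 3) := by
  have h1 := hf.lower_stringVector 0
  rw [zero_add] at h1
  rw [adjacencyT_smul_restrict]
  simp only [← map_smul, ← map_add]
  congr 1
  simp only [LinearMap.add_apply, h1, hf.lower_stringVector, hf.lower_stringVector_zero,
    raise_stringVector, map_add, map_smul, smul_add, add_assoc, smul_smul, Nat.reduceAdd]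
  push_cast
  module

theorem dual_injective (k n : ℕ) :
    Function.Injective fun i : Fin n => (D : ℂ) - 2 * (2 * ((i : ℕ) : ℂ) + k) := by
  intro i j hij
  have h1 : ((i : ℕ) : ℂ) = (j : ℕ) := by linear_combination (-1 / 4) * hij
  exact Fin.ext (by exact_mod_cast h1)

/-- The members `j = 2 i + ε` of the string through a lowest weight vector `f` of weight `r` span a
submodule of the standard module. Here `ε` is `0` or `1` according to the parity of `r`, and `hm`,
`hm'` say that `i = m` gives the last nonzero one of them. -/
theorem IsLowest.exists_submodule (hD : 3 ≤ D) {x : HalvedCubeVertex D} {r : ℕ}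
    {f : (Fin D → ZMod 2) → ℂ} (hf : IsLowest x.1 r f) (h0 : f ≠ 0) {ε k m : ℕ}
    (hk : k = r + ε) (hkeven : Even k) (hm : 2 * m + ε + 2 * r ≤ D)
    (hm' : D < 2 * (m + 1) + ε + 2 * r) {α β γ : ℕ → ℂ}
    (hA : ∀ i, adjacencyT x • restrict x (stringVector x.1 f (2 * i + ε))
      = α i • restrict x (stringVector x.1 f (2 * i + ε))
        + β i • restrict x (stringVector x.1 f (2 * (i + 1) + ε))
        + if i = 0 then 0 else γ i • restrict x (stringVector x.1 f (2 * (i - 1) + ε))) :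
    ∃ S : Submodule (terwilliger x) (StandardModule x),
      (∀ i ≤ m, restrict x (stringVector x.1 f (2 * i + ε)) ∈ S) ∧
      RepresentedBy x (tridiagonal (m + 1) α β γ) (matrixDual D k (m + 1)) S := by
  let b : ℕ → StandardModule x := fun i => restrict x (stringVector x.1 f (2 * i + ε))
  have hmem : ∀ i, stringVector x.1 f (2 * i + ε) ∈ weightSpace x.1 (2 * i + k) := fun i => by
    have := stringVector_mem hf.mem (2 * i + ε)
    rwa [show r + (2 * i + ε) = 2 * i + k by omega] at this
  have hlast : b (m + 1) = 0 := by
    have : stringVector x.1 f (2 * (m + 1) + ε) = 0 := by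
      by_contra hne
      have := (hf.stringVector_ne_zero_iff h0 _).1 hne
      omega
    simp only [b, this, map_zero]
  have hdual : ∀ i, dualAdjacencyT x • b i = ((D : ℂ) - 2 * (2 * i + k)) • b i := fun i => by
    have := dualAdjacencyT_smul_restrict hD x (hmem i)
    push_cast at this
    exact this
  have hli : LinearIndependent ℂ fun i : Fin (m + 1) => b i := by
    refine Module.End.eigenvectors_linearIndependent'
      (actionMap (StandardModule x) (dualAdjacencyT x)) _
      (dual_injective (D := D) k (m + 1)) _ fun i => ?_
    rw [Module.End.hasEigenvector_iff, Module.End.mem_eigenspace_iff]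
    refine ⟨hdual i, ?_⟩
    rw [Ne, restrict_eq_zero_iff x ((even_two_mul _).add hkeven) (hmem i), ← Ne,
      hf.stringVector_ne_zero_iff h0]
    have := i.2
    omega
  obtain ⟨S, hS, hrep⟩ := exists_submodule_representedBy (x := x)
    (B := tridiagonal (m + 1) α β γ) (Bs := matrixDual D k (m + 1)) hli
    (fun j => by
      rw [sum_tridiagonal_smul α β γ hlast j]
      exact hA j)
    (fun j => by
      rw [matrixDual, sum_diagonal_smul]
      exact hdual j)
  exact ⟨S, fun i hi => hS ⟨i, by omega⟩, hrep⟩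

theorem IsLowest.exists_isM (hD : 3 ≤ D) {x : HalvedCubeVertex D} {k : ℕ}
    {f : (Fin D → ZMod 2) → ℂ} (hf : IsLowest x.1 k f) (h0 : f ≠ 0) (hk : k ∈ indexM D) :
    ∃ S : Submodule (terwilliger x) (StandardModule x),
      (∀ i ≤ D / 2 - k, restrict x (stringVector x.1 f (2 * i)) ∈ S) ∧ IsM x k S := by
  obtain ⟨hk1, hk2⟩ := hk
  refine hf.exists_submodule hD h0 (ε := 0) rfl hk1 (by omega) (by omega) fun i => ?_
  rcases i with _ | i
  · refine hf.adjacencyT_smul_zero.trans ?_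
    simp
  · refine (hf.adjacencyT_smul_add_two (2 * i)).trans ?_
    rw [if_neg (Nat.succ_ne_zero i)]
    congr 2 <;> (congr 1; push_cast; ring)

theorem IsLowest.exists_isN (hD : 3 ≤ D) {x : HalvedCubeVertex D} {r : ℕ}
    {f : (Fin D → ZMod 2) → ℂ} (hf : IsLowest x.1 r f) (h0 : f ≠ 0) (hk : r + 1 ∈ indexN D) :
    ∃ S : Submodule (terwilliger x) (StandardModule x),
      (∀ i ≤ (D + 1) / 2 - (r + 1), restrict x (stringVector x.1 f (2 * i + 1)) ∈ S) ∧
      IsN x (r + 1) S := by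
  obtain ⟨hk1, hk2, hk3⟩ := hk
  refine hf.exists_submodule hD h0 (ε := 1) rfl hk1 (by omega) (by omega) fun i => ?_
  rcases i with _ | i
  · refine hf.adjacencyT_smul_one.trans ?_
    rw [if_pos rfl, add_zero]
    congr 2 <;> (push_cast; ring)
  · refine (hf.adjacencyT_smul_add_two (2 * i + 1)).trans ?_
    rw [if_neg (Nat.succ_ne_zero i)]
    congr 2 <;> (congr 1; push_cast; ring)

/-! ### Irreducibility -/

theorem IsM.isSimpleModule {x : HalvedCubeVertex D} {k : ℕ} (hk : k ∈ indexM D) {V : Type u}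
    [AddCommGroup V] [Module ℂ V] [Module (terwilliger x) V]
    [IsScalarTower ℂ (terwilliger x) V] (h : IsM x k V) : IsSimpleModule (terwilliger x) V := by
  obtain ⟨-, hk⟩ := hk
  refine RepresentedBy.isSimpleModule (dual_injective k _) (fun i _ => ?_) (fun i _ hi => ?_) h
  · exact_mod_cast (by positivity : (i + 1) * (2 * i + 1) ≠ 0)
  -- up to the factor `1 / 2` the entry is `(t + 1) (t + 2)` with `t = D - 2 i - 2 k ≥ 0`
  · obtain ⟨t, rfl⟩ := Nat.exists_eq_add_of_le (show 2 * i + 2 * k ≤ D by omega)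
    have h1 : ((t : ℂ) + 1) * (t + 2) ≠ 0 := by
      exact_mod_cast (by positivity : (t + 1) * (t + 2) ≠ 0)
    push_cast
    refine fun h2 => h1 ?_
    linear_combination 2 * h2

theorem IsN.isSimpleModule {x : HalvedCubeVertex D} {k : ℕ} (hk : k ∈ indexN D) {V : Type u}
    [AddCommGroup V] [Module ℂ V] [Module (terwilliger x) V]
    [IsScalarTower ℂ (terwilliger x) V] (h : IsN x k V) : IsSimpleModule (terwilliger x) V := by
  obtain ⟨-, -, hk⟩ := hk
  refine RepresentedBy.isSimpleModule (dual_injective k _) (fun i _ => ?_) (fun i _ hi => ?_) h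
  · exact_mod_cast (by positivity : (i + 1) * (2 * i + 3) ≠ 0)
  -- up to the factor `1 / 2` the entry is `(t + 1) (t + 2)` with `t = D + 1 - 2 i - 2 k ≥ 0`
  · obtain ⟨t, ht⟩ := Nat.exists_eq_add_of_le (show 2 * i + 2 * k ≤ D + 1 by omega)
    have ht' : (D : ℂ) + 1 = 2 * i + 2 * k + t := by exact_mod_cast ht
    have h1 : ((t : ℂ) + 1) * (t + 2) ≠ 0 := by
      exact_mod_cast (by positivity : (t + 1) * (t + 2) ≠ 0)
    have h3 : (t : ℂ) = D + 1 - 2 * i - 2 * k := by linear_combination -ht'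
    rw [h3] at h1
    refine fun h2 => h1 ?_
    linear_combination 2 * h2

/-! ### The classification of the irreducible modules -/

/-- `V` is one of the modules `M_k`, `N_k`. -/
def IsListed (x : HalvedCubeVertex D) (V : Type u) [AddCommGroup V] [Module ℂ V]
    [Module (terwilliger x) V] : Prop :=
  (∃ k ∈ indexM D, IsM x k V) ∨ ∃ k ∈ indexN D, IsN x k V

theorem IsListed.isSimpleModule {x : HalvedCubeVertex D} {V : Type u} [AddCommGroup V]
    [Module ℂ V] [Module (terwilliger x) V] [IsScalarTower ℂ (terwilliger x) V]
    (h : IsListed x V) : IsSimpleModule (terwilliger x) V := by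
  rcases h with ⟨k, hk, h⟩ | ⟨k, hk, h⟩
  · exact h.isSimpleModule hk
  · exact h.isSimpleModule hk

theorem sSup_isListed_eq_top (hD : 3 ≤ D) (x : HalvedCubeVertex D) :
    sSup {S : Submodule (terwilliger x) (StandardModule x) | IsListed x S} = ⊤ := by
  rw [eq_top_iff]
  rintro w -
  obtain ⟨F, rfl⟩ := restrict_surjective x w
  have hF : F ∈ stringSpan x.1 := stringSpan_eq_top x.1 ▸ Submodule.mem_top
  have hle : ∀ {S : Submodule (terwilliger x) (StandardModule x)}, IsListed x S → ∀ {w}, w ∈ S →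
      w ∈ sSup {S : Submodule (terwilliger x) (StandardModule x) | IsListed x S} :=
    fun {S} hS {w} hw => (show S ≤ sSup _ from le_sSup hS) hw
  induction hF using Submodule.span_induction with
  | mem g hg =>
    obtain ⟨r, f, j, hf, h0, rfl⟩ := hg
    by_cases hpar : Even (r + j)
    swap
    · rw [restrict_eq_zero_of_odd x hpar (stringVector_mem hf.mem j)]
      exact Submodule.zero_mem _
    by_cases hne : stringVector x.1 f j = 0
    · rw [hne, map_zero]
      exact Submodule.zero_mem _
    have hj := (hf.stringVector_ne_zero_iff h0 j).1 hne
    rcases Nat.even_or_odd r with hr | hr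
    · obtain ⟨i, rfl⟩ := (Nat.even_add.1 hpar).1 hr
      have hk : r ∈ indexM D := ⟨hr, by omega⟩
      obtain ⟨S, hS, hM⟩ := hf.exists_isM hD h0 hk
      rw [← two_mul]
      exact hle (Or.inl ⟨r, hk, hM⟩) (hS i (by omega))
    · have hjodd : Odd j := by
        rw [← Nat.not_even_iff_odd] at hr ⊢
        exact fun h => hr ((Nat.even_add.1 hpar).2 h)
      obtain ⟨i, rfl⟩ := hjodd
      have hr1 := hr.pos
      have hk : r + 1 ∈ indexN D := ⟨hr.add_one, by omega, by omega⟩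
      obtain ⟨S, hS, hN⟩ := hf.exists_isN hD h0 hk
      exact hle (Or.inr ⟨r + 1, hk, hN⟩) (hS i (by omega))
  | zero => rw [map_zero]; exact Submodule.zero_mem _
  | add F G _ _ hF hG => rw [map_add]; exact Submodule.add_mem _ hF hG
  | smul c F _ hF =>
    rw [map_smul, ← algebraMap_smul (terwilliger x) c]
    exact Submodule.smul_mem _ _ hF

/-- A matrix in the Terwilliger algebra as the family of its columns. This embeds the regular module
in a power of the standard module. -/
def columns (x : HalvedCubeVertex D) :
    terwilliger x →ₗ[terwilliger x] (HalvedCubeVertex D → StandardModule x) where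
  toFun t z := fun y => t.1 y z
  map_add' _ _ := rfl
  map_smul' _ _ := rfl

theorem columns_injective (x : HalvedCubeVertex D) : Function.Injective (columns x) :=
  fun _ _ h => Subtype.ext (Matrix.ext fun y z => congr_fun (congr_fun h z) y)

/-- Every irreducible module is a quotient of the regular module. The latter embeds in a power of
the semisimple standard module, so some nonzero homomorphism leads from the standard module onto the
given one, and by Schur's lemma it is an isomorphism on one of the listed submodules. -/
theorem exists_isListed_equiv (hD : 3 ≤ D) (x : HalvedCubeVertex D) (V : Type v)
    [AddCommGroup V] [Module (terwilliger x) V] [IsSimpleModule (terwilliger x) V] :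
    ∃ S : Submodule (terwilliger x) (StandardModule x), IsListed x S ∧
      Nonempty (V ≃ₗ[terwilliger x] S) := by
  have hss : IsSemisimpleModule (terwilliger x) (StandardModule x) := by
    refine IsSemisimpleModule.of_sSup_simples_eq_top (top_unique ?_)
    rw [← sSup_isListed_eq_top hD x]
    exact sSup_le_sSup fun S hS => IsListed.isSimpleModule hS
  have := IsSimpleModule.nontrivial (terwilliger x) V
  obtain ⟨w, hw⟩ := exists_ne (0 : V)
  obtain ⟨h, hh⟩ := IsSemisimpleModule.extension_property (columns x) (columns_injective x)
    (LinearMap.toSpanSingleton (terwilliger x) V w)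
  have hne : h ≠ 0 := by
    rintro rfl
    have := LinearMap.congr_fun hh 1
    simp only [LinearMap.zero_comp, LinearMap.zero_apply, LinearMap.toSpanSingleton_apply,
      one_smul] at this
    exact hw this.symm
  obtain ⟨z, hz⟩ :
      ∃ z, h ∘ₗ LinearMap.single (terwilliger x) (fun _ => StandardModule x) z ≠ 0 := by
    by_contra! hall
    exact hne (LinearMap.pi_ext' fun z => by rw [hall z, LinearMap.zero_comp])
  obtain ⟨S, hS, hφ⟩ := LinearMap.exists_ne_zero_of_sSup_eq_top hz _ (sSup_isListed_eq_top hD x)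
  have hSsimple : IsSimpleModule (terwilliger x) S := IsListed.isSimpleModule hS
  have hb := LinearMap.bijective_of_ne_zero (R := terwilliger x) (M := S) (N := V) hφ
  exact ⟨S, hS, ⟨(LinearEquiv.ofBijective
    ((h ∘ₗ LinearMap.single (terwilliger x) (fun _ => StandardModule x) z) ∘ₗ S.subtype)
    hb).symm⟩⟩

/-! ### Isomorphisms between the listed modules -/

/-- The eigenvalue `D - 2 k` of `A*` occurs in an isomorphic module with parameter `l` only if
`l ≤ k`; for `k = l` it belongs to the first basis vector of both modules. -/
theorem RepresentedBy.index_le {x : HalvedCubeVertex D} {k l n n' : ℕ}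
    {B : Matrix (Fin (n + 1)) (Fin (n + 1)) ℂ} {B' : Matrix (Fin (n' + 1)) (Fin (n' + 1)) ℂ}
    {V : Type u} [AddCommGroup V] [Module ℂ V] [Module (terwilliger x) V]
    [IsScalarTower ℂ (terwilliger x) V]
    {V' : Type v} [AddCommGroup V'] [Module ℂ V'] [Module (terwilliger x) V']
    [IsScalarTower ℂ (terwilliger x) V']
    (h : RepresentedBy x B (matrixDual D k _) V) (h' : RepresentedBy x B' (matrixDual D l _) V')
    (e : V ≃ₗ[terwilliger x] V') : l ≤ k ∧ (k = l → B 0 0 = B' 0 0) := by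
  obtain ⟨i, hi, hB⟩ := h.eigenvalue_match (dual_injective k _) (dual_injective l _) h' e 0
  have hi' : k = 2 * (i : ℕ) + l := by
    have : (k : ℂ) = 2 * (i : ℕ) + l := by
      simp only [Fin.val_zero, Nat.cast_zero] at hi
      linear_combination (-1 / 2) * hi
    exact_mod_cast this
  refine ⟨by omega, fun hkl => ?_⟩
  have hi0 : (i : ℕ) = 0 := by omega
  rw [hB, show i = 0 from Fin.ext hi0]

theorem IsM.index_eq {x : HalvedCubeVertex D} {k l : ℕ}
    {V : Type u} [AddCommGroup V] [Module ℂ V] [Module (terwilliger x) V]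
    [IsScalarTower ℂ (terwilliger x) V]
    {V' : Type v} [AddCommGroup V'] [Module ℂ V'] [Module (terwilliger x) V']
    [IsScalarTower ℂ (terwilliger x) V'] (h : IsM x k V) (h' : IsM x l V')
    (e : V ≃ₗ[terwilliger x] V') : k = l :=
  le_antisymm (RepresentedBy.index_le h' h e.symm).1 (RepresentedBy.index_le h h' e).1

theorem IsN.index_eq {x : HalvedCubeVertex D} {k l : ℕ}
    {V : Type u} [AddCommGroup V] [Module ℂ V] [Module (terwilliger x) V]
    [IsScalarTower ℂ (terwilliger x) V]
    {V' : Type v} [AddCommGroup V'] [Module ℂ V'] [Module (terwilliger x) V']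
    [IsScalarTower ℂ (terwilliger x) V'] (h : IsN x k V) (h' : IsN x l V')
    (e : V ≃ₗ[terwilliger x] V') : k = l :=
  le_antisymm (RepresentedBy.index_le h' h e.symm).1 (RepresentedBy.index_le h h' e).1

theorem IsM.isEmpty_equiv_of_isN {x : HalvedCubeVertex D} {k l : ℕ} (hk : k ∈ indexM D)
    {V : Type u} [AddCommGroup V] [Module ℂ V] [Module (terwilliger x) V]
    [IsScalarTower ℂ (terwilliger x) V]
    {V' : Type v} [AddCommGroup V'] [Module ℂ V'] [Module (terwilliger x) V']
    [IsScalarTower ℂ (terwilliger x) V'] (h : IsM x k V) (h' : IsN x l V') :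
    IsEmpty (V ≃ₗ[terwilliger x] V') := by
  refine ⟨fun e => ?_⟩
  obtain ⟨h1, h2⟩ := RepresentedBy.index_le h h' e
  have hkl : k = l := le_antisymm (RepresentedBy.index_le h' h e.symm).1 h1
  subst hkl
  -- the entries in position `(0, 0)` are `-k` and `(D - 2 k + 1) - k + 1`
  have h3 := h2 rfl
  simp only [matrixM, matrixN, tridiagonal, Matrix.of_apply, Fin.val_zero, if_true,
    Nat.cast_zero] at h3
  have h4 : D + 2 = 2 * k := by
    exact_mod_cast (by linear_combination -h3 : (D : ℂ) + 2 = 2 * k)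
  have := hk.2
  omega

end StandardModule

end HalvedCube

theorem theorem2p3 (D : ℕ) (hD : 3 ≤ D) (x : HalvedCubeVertex D) :
    -- the modules `M_k` and `N_k` exist
    (∀ k ∈ HalvedCube.indexM D,
      ∃ (V : Type u) (_ : AddCommGroup V) (_ : Module ℂ V) (_ : Module (HalvedCube.terwilliger x) V)
        (_ : IsScalarTower ℂ (HalvedCube.terwilliger x) V), HalvedCube.IsM x k V) ∧
    (∀ k ∈ HalvedCube.indexN D,
      ∃ (V : Type u) (_ : AddCommGroup V) (_ : Module ℂ V) (_ : Module (HalvedCube.terwilliger x) V)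
        (_ : IsScalarTower ℂ (HalvedCube.terwilliger x) V), HalvedCube.IsN x k V) ∧
    -- whichever modules `M_k` and `N_k` are taken
    (∀ (M N : ℕ → Type u)
      [∀ k, AddCommGroup (M k)] [∀ k, Module ℂ (M k)]
      [∀ k, Module (HalvedCube.terwilliger x) (M k)]
      [∀ k, IsScalarTower ℂ (HalvedCube.terwilliger x) (M k)]
      [∀ k, AddCommGroup (N k)] [∀ k, Module ℂ (N k)]
      [∀ k, Module (HalvedCube.terwilliger x) (N k)]
      [∀ k, IsScalarTower ℂ (HalvedCube.terwilliger x) (N k)],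
      (∀ k ∈ HalvedCube.indexM D, HalvedCube.IsM x k (M k)) →
      (∀ k ∈ HalvedCube.indexN D, HalvedCube.IsN x k (N k)) →
      -- they are irreducible
      (∀ k ∈ HalvedCube.indexM D, IsSimpleModule (HalvedCube.terwilliger x) (M k)) ∧
      (∀ k ∈ HalvedCube.indexN D, IsSimpleModule (HalvedCube.terwilliger x) (N k)) ∧
      -- every irreducible module is isomorphic to one of them
      (∀ (V : Type v) [AddCommGroup V] [Module (HalvedCube.terwilliger x) V],
        IsSimpleModule (HalvedCube.terwilliger x) V →
        (∃ k ∈ HalvedCube.indexM D, Nonempty (V ≃ₗ[HalvedCube.terwilliger x] M k)) ∨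
        (∃ k ∈ HalvedCube.indexN D, Nonempty (V ≃ₗ[HalvedCube.terwilliger x] N k))) ∧
      -- they are mutually non-isomorphic
      (∀ k ∈ HalvedCube.indexM D, ∀ l ∈ HalvedCube.indexM D, k ≠ l →
        IsEmpty (M k ≃ₗ[HalvedCube.terwilliger x] M l)) ∧
      (∀ k ∈ HalvedCube.indexN D, ∀ l ∈ HalvedCube.indexN D, k ≠ l →
        IsEmpty (N k ≃ₗ[HalvedCube.terwilliger x] N l)) ∧
      (∀ k ∈ HalvedCube.indexM D, ∀ l ∈ HalvedCube.indexN D,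
        IsEmpty (M k ≃ₗ[HalvedCube.terwilliger x] N l))) := by
  refine ⟨fun k hk => ?_, fun k hk => ?_, fun M N _ _ _ _ _ _ _ _ hM hN => ?_⟩
  · obtain ⟨f, hf, h0⟩ := HalvedCube.exists_isLowest x.1 (r := k) (by have := hk.2; omega)
    obtain ⟨S, -, hS⟩ := hf.exists_isM hD h0 hk
    exact ⟨ULift.{u} S, inferInstance, inferInstance, inferInstance, inferInstance,
      HalvedCube.RepresentedBy.of_equiv hS ULift.moduleEquiv.symm⟩
  · obtain ⟨r, rfl⟩ := Nat.exists_eq_add_of_le' (one_le_two.trans hk.2.1)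
    obtain ⟨f, hf, h0⟩ := HalvedCube.exists_isLowest x.1 (r := r) (by have := hk.2.2; omega)
    obtain ⟨S, -, hS⟩ := hf.exists_isN hD h0 hk
    exact ⟨ULift.{u} S, inferInstance, inferInstance, inferInstance, inferInstance,
      HalvedCube.RepresentedBy.of_equiv hS ULift.moduleEquiv.symm⟩
  · refine ⟨fun k hk => (hM k hk).isSimpleModule hk, fun k hk => (hN k hk).isSimpleModule hk,
      fun V _ _ _ => ?_, fun k hk l hl hkl => ⟨fun e => hkl ((hM k hk).index_eq (hM l hl) e)⟩,
      fun k hk l hl hkl => ⟨fun e => hkl ((hN k hk).index_eq (hN l hl) e)⟩,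
      fun k hk l hl => (hM k hk).isEmpty_equiv_of_isN hk (hN l hl)⟩
    obtain ⟨S, hS, ⟨e⟩⟩ := HalvedCube.exists_isListed_equiv hD x V
    rcases hS with ⟨k, hk, hS⟩ | ⟨k, hk, hS⟩
    · obtain ⟨e'⟩ := HalvedCube.RepresentedBy.nonempty_equiv hS (hM k hk)
      exact Or.inl ⟨k, hk, ⟨e.trans e'⟩⟩
    · obtain ⟨e'⟩ := HalvedCube.RepresentedBy.nonempty_equiv hS (hN k hk)
      exact Or.inr ⟨k, hk, ⟨e.trans e'⟩⟩
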